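/- Let $\mathbb{D}$ be the open unit disk in $\mathbb{C}$, and let $\mathcal{B}$ be the Bloch space, that is, the Banach space of all analytic functions $f$ on $\mathbb{D}$ with $\|f\|_{\beta}=\sup_{z\in\mathbb{D}}(1-|z|^2)|f'(z)|<\infty$, equipped with the norm $\|f\|_{\mathcal{B}}=|f(0)|+\|f\|_{\beta}$. For an analytic self-map $\varphi$ of $\mathbb{D}$, let $C_\varphi f=f\circ\varphi$ be the composition operator on $\mathcal{B}$, and let $\varphi^n$ denote the pointwise $n$-th power of $\varphi$. Let $\lambda_1,\lambda_2$ be nonzero complex scalars, and let $\varphi,\psi$ be any two analytic self-maps of $\mathbb{D}$. Suppose that neither $C_\varphi$ nor $C_\psi$ is compact on $\mathcal{B}$. Then the operator $\lambda_1C_\varphi+\lambda_2C_\psi$ is compact on $\mathcal{B}$ if and only if $\lambda_1+\lambda_2=0$ and $\lim_{n\to\infty}\|\varphi^n-\psi^n\|_{\mathcal{B}}=0$. -/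

import Mathlib

open Filter Topology Metric Complex.UnitDisc

noncomputable section

namespace BlochSpace

/-- Extension by zero of a function on the open unit disc to the whole plane. It only serves to
speak of holomorphy and of complex derivatives at points of the disc. -/
def zeroExt (f : 𝔻 → ℂ) (z : ℂ) : ℂ :=
  if h : ‖z‖ < 1 then f (Complex.UnitDisc.mk z h) else 0

/-- `f` is analytic in the open unit disc, i.e. `f ∈ H(𝔻)`. -/
def IsAnalytic (f : 𝔻 → ℂ) : Prop := DifferentiableOn ℂ (zeroExt f) (ball 0 1)

/-- The complex derivative `f'` of a function on the disc. -/
def discDeriv (f : 𝔻 → ℂ) (z : 𝔻) : ℂ := deriv (zeroExt f) (z : ℂ)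

theorem zeroExt_coe (f : 𝔻 → ℂ) (z : 𝔻) : zeroExt f z = f z := by
  simp [zeroExt, z.norm_lt_one]

theorem zeroExt_eqOn {f : 𝔻 → ℂ} {F : ℂ → ℂ} (h : ∀ z : 𝔻, f z = F z) :
    Set.EqOn (zeroExt f) F (ball 0 1) := by
  intro z hz
  have hz' : ‖z‖ < 1 := by simpa using hz
  have := zeroExt_coe f (Complex.UnitDisc.mk z hz')
  rw [h] at this
  simpa using this

theorem coe_mem_ball (z : 𝔻) : (z : ℂ) ∈ ball (0 : ℂ) 1 := by simpa using z.norm_lt_one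

theorem isAnalytic_of_eq {f : 𝔻 → ℂ} {F : ℂ → ℂ} (h : ∀ z : 𝔻, f z = F z)
    (hF : DifferentiableOn ℂ F (ball 0 1)) : IsAnalytic f :=
  hF.congr (zeroExt_eqOn h)

theorem discDeriv_of_eq {f : 𝔻 → ℂ} {F : ℂ → ℂ} (h : ∀ z : 𝔻, f z = F z) (z : 𝔻) :
    discDeriv f z = deriv F z :=
  Filter.EventuallyEq.deriv_eq
    ((zeroExt_eqOn h).eventuallyEq_of_mem (isOpen_ball.mem_nhds (coe_mem_ball z)))

theorem IsAnalytic.hasDerivAt {f : 𝔻 → ℂ} (hf : IsAnalytic f) (z : 𝔻) :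
    HasDerivAt (zeroExt f) (discDeriv f z) z :=
  (hf.differentiableAt (isOpen_ball.mem_nhds (coe_mem_ball z))).hasDerivAt

theorem isAnalytic_const (c : ℂ) : IsAnalytic (fun _ => c) :=
  isAnalytic_of_eq (F := fun _ => c) (fun _ => rfl) (differentiableOn_const c)

theorem discDeriv_const (c : ℂ) (z : 𝔻) : discDeriv (fun _ => c) z = 0 := by
  rw [discDeriv_of_eq (F := fun _ => c) (fun _ => rfl), deriv_const]

theorem IsAnalytic.add {f g : 𝔻 → ℂ} (hf : IsAnalytic f) (hg : IsAnalytic g) :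
    IsAnalytic (f + g) :=
  isAnalytic_of_eq (F := fun z => zeroExt f z + zeroExt g z)
    (fun z => by simp [zeroExt_coe]) (DifferentiableOn.fun_add hf hg)

theorem discDeriv_add {f g : 𝔻 → ℂ} (hf : IsAnalytic f) (hg : IsAnalytic g) (z : 𝔻) :
    discDeriv (f + g) z = discDeriv f z + discDeriv g z := by
  rw [discDeriv_of_eq (F := fun z => zeroExt f z + zeroExt g z) (fun z => by simp [zeroExt_coe])]
  exact ((hf.hasDerivAt z).fun_add (hg.hasDerivAt z)).deriv

theorem IsAnalytic.smul {f : 𝔻 → ℂ} (c : ℂ) (hf : IsAnalytic f) : IsAnalytic (c • f) :=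
  isAnalytic_of_eq (F := fun z => c * zeroExt f z)
    (fun z => by simp [zeroExt_coe]) (DifferentiableOn.const_mul hf c)

theorem discDeriv_smul {f : 𝔻 → ℂ} (c : ℂ) (hf : IsAnalytic f) (z : 𝔻) :
    discDeriv (c • f) z = c * discDeriv f z := by
  rw [discDeriv_of_eq (F := fun z => c * zeroExt f z) (fun z => by simp [zeroExt_coe])]
  exact ((hf.hasDerivAt z).const_mul c).deriv

/-- The quantity `(1 - |z|²) |f'(z)|`. -/
def weight (f : 𝔻 → ℂ) (z : 𝔻) : ℝ := (1 - ‖(z : ℂ)‖ ^ 2) * ‖discDeriv f z‖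

theorem one_sub_sq_pos (z : 𝔻) : 0 < 1 - ‖(z : ℂ)‖ ^ 2 := by
  have := z.sq_norm_lt_one
  linarith

theorem weight_nonneg (f : 𝔻 → ℂ) (z : 𝔻) : 0 ≤ weight f z :=
  mul_nonneg (one_sub_sq_pos z).le (norm_nonneg _)

theorem weight_add_le {f g : 𝔻 → ℂ} (hf : IsAnalytic f) (hg : IsAnalytic g) (z : 𝔻) :
    weight (f + g) z ≤ weight f z + weight g z := by
  simp only [weight, discDeriv_add hf hg, ← mul_add]
  exact mul_le_mul_of_nonneg_left (norm_add_le _ _) (one_sub_sq_pos z).le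

theorem weight_smul {f : 𝔻 → ℂ} (c : ℂ) (hf : IsAnalytic f) (z : 𝔻) :
    weight (c • f) z = ‖c‖ * weight f z := by
  simp only [weight, discDeriv_smul c hf, norm_mul]
  ring

/-- The Bloch space as a space of functions on the disc: all `f ∈ H(𝔻)` with
`sup_{z ∈ 𝔻} (1 - |z|²) |f'(z)| < ∞`. -/
def blochSubmodule : Submodule ℂ (𝔻 → ℂ) where
  carrier := {f | IsAnalytic f ∧ BddAbove (Set.range (weight f))}
  zero_mem' := by
    refine ⟨isAnalytic_const 0, 0, ?_⟩
    rintro _ ⟨z, rfl⟩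
    exact (by simp [weight, discDeriv_const] : weight (fun _ => (0 : ℂ)) z = 0).le
  add_mem' := by
    rintro f g ⟨hf, A, hA⟩ ⟨hg, B, hB⟩
    refine ⟨hf.add hg, A + B, ?_⟩
    rintro _ ⟨z, rfl⟩
    exact (weight_add_le hf hg z).trans (add_le_add (hA ⟨z, rfl⟩) (hB ⟨z, rfl⟩))
  smul_mem' := by
    rintro c f ⟨hf, A, hA⟩
    refine ⟨hf.smul c, ‖c‖ * A, ?_⟩
    rintro _ ⟨z, rfl⟩
    rw [weight_smul c hf]
    exact mul_le_mul_of_nonneg_left (hA ⟨z, rfl⟩) (norm_nonneg c)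

/-- The Bloch space `𝓑`. This is a type of its own, so that its topology is the one of the Bloch
norm and not the topology of pointwise convergence. -/
def Bloch : Type := blochSubmodule

instance : AddCommGroup Bloch := inferInstanceAs (AddCommGroup blochSubmodule)

instance : Module ℂ Bloch := inferInstanceAs (Module ℂ blochSubmodule)

instance : CoeFun Bloch (fun _ => 𝔻 → ℂ) := ⟨fun f => f.1⟩

theorem Bloch.ext {f g : Bloch} (h : ∀ z, f z = g z) : f = g := Subtype.ext (funext h)

theorem Bloch.analytic (f : Bloch) : IsAnalytic f := f.2.1

theorem Bloch.bddAbove (f : Bloch) : BddAbove (Set.range (weight f)) := f.2.2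

/-- The seminorm `‖f‖_β = sup_{z ∈ 𝔻} (1 - |z|²) |f'(z)|`. -/
def Bloch.beta (f : Bloch) : ℝ := ⨆ z : 𝔻, weight f z

/-- The Bloch norm `‖f‖_𝓑 = |f(0)| + ‖f‖_β`. -/
instance : Norm Bloch := ⟨fun f => ‖f 0‖ + f.beta⟩

theorem Bloch.norm_def (f : Bloch) : ‖f‖ = ‖f 0‖ + ⨆ z : 𝔻, weight f z := rfl

theorem Bloch.beta_nonneg (f : Bloch) : 0 ≤ f.beta := Real.iSup_nonneg (weight_nonneg f)

theorem Bloch.eq_zero_of_norm (f : Bloch) (h : ‖f‖ = 0) : f = 0 := by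
  have h0 : ‖f 0‖ + f.beta = 0 := h
  have h1 : f 0 = 0 := by
    have := f.beta_nonneg
    have := norm_nonneg (f 0)
    exact norm_eq_zero.1 (by linarith)
  have h2 : f.beta = 0 := by simpa [h1] using h0
  have h3 (z : 𝔻) : deriv (zeroExt f) (z : ℂ) = 0 := by
    have hz : weight f z ≤ 0 := h2 ▸ le_ciSup f.bddAbove z
    have hz' : (1 - ‖(z : ℂ)‖ ^ 2) * ‖discDeriv f z‖ = 0 := le_antisymm hz (weight_nonneg f z)
    rcases mul_eq_zero.1 hz' with h | h
    · exact absurd h (one_sub_sq_pos z).ne'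
    · exact norm_eq_zero.1 h
  refine Bloch.ext fun z => ?_
  have h4 : zeroExt f z = zeroExt f ((0 : 𝔻) : ℂ) := by
    refine IsOpen.is_const_of_deriv_eq_zero isOpen_ball (convex_ball (0 : ℂ) 1).isPreconnected
      f.analytic ?_ (coe_mem_ball z) (coe_mem_ball 0)
    intro w hw
    have hw' : ‖w‖ < 1 := by simpa using hw
    have := h3 (Complex.UnitDisc.mk w hw')
    rw [Complex.UnitDisc.coe_mk] at this
    exact this
  rw [zeroExt_coe, zeroExt_coe, h1] at h4
  exact h4

theorem Bloch.core : NormedSpace.Core ℂ Bloch where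
  norm_nonneg f := add_nonneg (norm_nonneg _) f.beta_nonneg
  norm_smul c f := by
    change ‖c * f 0‖ + (⨆ z : 𝔻, weight (c • (f : 𝔻 → ℂ)) z) = ‖c‖ * (‖f 0‖ + ⨆ z : 𝔻, weight f z)
    simp only [weight_smul c f.analytic]
    rw [← Real.mul_iSup_of_nonneg (norm_nonneg c), norm_mul, mul_add]
  norm_triangle f g := by
    change ‖f 0 + g 0‖ + (⨆ z : 𝔻, weight ((f : 𝔻 → ℂ) + (g : 𝔻 → ℂ)) z) ≤
      (‖f 0‖ + ⨆ z : 𝔻, weight f z) + (‖g 0‖ + ⨆ z : 𝔻, weight g z)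
    have h : (⨆ z : 𝔻, weight ((f : 𝔻 → ℂ) + (g : 𝔻 → ℂ)) z) ≤
        (⨆ z : 𝔻, weight f z) + ⨆ z : 𝔻, weight g z :=
      ciSup_le fun z => (weight_add_le f.analytic g.analytic z).trans
        (add_le_add (le_ciSup f.bddAbove z) (le_ciSup g.bddAbove z))
    have := norm_add_le (f 0) (g 0)
    linarith
  norm_eq_zero_iff f := by
    refine ⟨f.eq_zero_of_norm, ?_⟩
    rintro rfl
    change ‖(0 : ℂ)‖ + (⨆ z : 𝔻, weight (fun _ => (0 : ℂ)) z) = 0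
    simp [weight, discDeriv_const]

instance : NormedAddCommGroup Bloch := NormedAddCommGroup.ofCore Bloch.core

instance : NormedSpace ℂ Bloch := NormedSpace.ofCore Bloch.core

/-- The disc automorphism `(w - a) / (1 - conj a * w)` maps the disc to itself. -/
theorem norm_mobius_lt {a w : ℂ} (ha : ‖a‖ < 1) (hw : ‖w‖ < 1) :
    1 - star a * w ≠ 0 ∧ ‖(w - a) / (1 - star a * w)‖ < 1 := by
  have h0 : 1 - star a * w ≠ 0 := by
    intro h
    have h1 : ‖star a * w‖ = 1 := by rw [← sub_eq_zero.1 h, norm_one]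
    rw [norm_mul, norm_star] at h1
    nlinarith [norm_nonneg a, norm_nonneg w]
  refine ⟨h0, ?_⟩
  rw [norm_div, div_lt_one (norm_pos_iff.2 h0)]
  refine lt_of_pow_lt_pow_left₀ 2 (norm_nonneg _) ?_
  have ha2 : ‖a‖ ^ 2 < 1 := by nlinarith [norm_nonneg a]
  have hw2 : ‖w‖ ^ 2 < 1 := by nlinarith [norm_nonneg w]
  have key : ‖1 - star a * w‖ ^ 2 - ‖w - a‖ ^ 2 = (1 - ‖a‖ ^ 2) * (1 - ‖w‖ ^ 2) := by
    simp only [← Complex.normSq_eq_norm_sq, Complex.normSq_apply]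
    simp
    ring
  nlinarith [mul_pos (sub_pos.2 ha2) (sub_pos.2 hw2)]

theorem hasDerivAt_mobius {a w : ℂ} (h : 1 - star a * w ≠ 0) :
    HasDerivAt (fun w => (w - a) / (1 - star a * w))
      ((1 - star a * a) / (1 - star a * w) ^ 2) w := by
  have h1 : HasDerivAt (fun w : ℂ => w - a) 1 w := (hasDerivAt_id w).sub_const a
  have h2 : HasDerivAt (fun w : ℂ => 1 - star a * w) (-(star a * 1)) w :=
    ((hasDerivAt_id w).const_mul (star a)).const_sub 1
  refine (h1.fun_div h2 h).congr_deriv ?_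
  congr 1
  ring

theorem star_mul_self_eq (a : ℂ) : star a * a = ((‖a‖ ^ 2 : ℝ) : ℂ) := by
  rw [← Complex.normSq_eq_norm_sq, Complex.normSq_eq_conj_mul_self]
  rfl

/-- The Schwarz-Pick inequality `(1 - |z|²) |φ'(z)| ≤ 1 - |φ(z)|²`. -/
theorem schwarz_pick {φ : 𝔻 → 𝔻} (hφ : IsAnalytic (fun z => (φ z : ℂ))) (z : 𝔻) :
    weight (fun z => (φ z : ℂ)) z ≤ 1 - ‖(φ z : ℂ)‖ ^ 2 := by
  set F : ℂ → ℂ := zeroExt (fun z => (φ z : ℂ)) with hF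
  set a : ℂ := (z : ℂ) with ha
  set b : ℂ := (φ z : ℂ) with hb
  have ha1 : ‖a‖ < 1 := z.norm_lt_one
  have hb1 : ‖b‖ < 1 := (φ z).norm_lt_one
  have hFm {w : ℂ} (hw : ‖w‖ < 1) : ‖F w‖ < 1 := by
    have := zeroExt_coe (fun z => (φ z : ℂ)) (Complex.UnitDisc.mk w hw)
    rw [Complex.UnitDisc.coe_mk] at this
    rw [hF, this]
    exact (φ _).norm_lt_one
  have hFa : F a = b := zeroExt_coe _ z
  let τ : ℂ → ℂ := fun w => (w - -a) / (1 - star (-a) * w)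
  let σ : ℂ → ℂ := fun w => (w - b) / (1 - star b * w)
  have hτ {w : ℂ} (hw : ‖w‖ < 1) := norm_mobius_lt (a := -a) (w := w) (by simpa using ha1) hw
  have hσ {w : ℂ} (hw : ‖w‖ < 1) := norm_mobius_lt (a := b) (w := w) hb1 hw
  have hτ0 : τ 0 = a := by simp [τ]
  have hσb : σ b = 0 := by simp [σ]
  let G : ℂ → ℂ := fun w => σ (F (τ w))
  have hFd {w : ℂ} (hw : ‖w‖ < 1) : DifferentiableAt ℂ F w :=
    hφ.differentiableAt (isOpen_ball.mem_nhds (by simpa using hw))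
  have hGd : DifferentiableOn ℂ G (ball 0 1) := by
    intro w hw
    have hw : ‖w‖ < 1 := by simpa using hw
    have h1 := (hasDerivAt_mobius (hτ hw).1).differentiableAt
    have h2 : DifferentiableAt ℂ F (τ w) := hFd (hτ hw).2
    have h3 := (hasDerivAt_mobius (hσ (hFm (hτ hw).2)).1).differentiableAt
    have h4 : DifferentiableAt ℂ (fun w => F (τ w)) w := DifferentiableAt.fun_comp' w h2 h1
    exact (DifferentiableAt.fun_comp' (g := σ) w h3 h4).differentiableWithinAt
  have hG0 : G 0 = 0 := by simp only [G, hτ0, hFa, hσb]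
  have hGm : Set.MapsTo G (ball 0 1) (closedBall (G 0) 1) := by
    intro w hw
    have hw : ‖w‖ < 1 := by simpa using hw
    rw [hG0, mem_closedBall_zero_iff]
    exact (hσ (hFm (hτ hw).2)).2.le
  have hG1 := Complex.norm_deriv_le_one_of_mapsTo_ball hGd hGm one_pos
  have e1 := hasDerivAt_mobius (hτ (w := 0) (by simp)).1
  have e2 : HasDerivAt F (discDeriv (fun z => (φ z : ℂ)) z) (τ 0) := by
    rw [hτ0]
    exact hφ.hasDerivAt z
  have e3 : HasDerivAt σ ((1 - star b * b) / (1 - star b * b) ^ 2) (F (τ 0)) := by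
    rw [hτ0, hFa]
    exact hasDerivAt_mobius (hσ hb1).1
  have e4 := (HasDerivAt.comp (h := fun w => F (τ w)) 0 e3 (HasDerivAt.comp (h := τ) 0 e2 e1)).deriv
  have e5 : deriv G 0 = _ := e4
  have hbne : 1 - ‖b‖ ^ 2 ≠ 0 := (one_sub_sq_pos (φ z)).ne'
  have hA : ‖(1 : ℂ) - ((‖a‖ ^ 2 : ℝ) : ℂ)‖ = 1 - ‖a‖ ^ 2 := by
    rw [← Complex.ofReal_one, ← Complex.ofReal_sub, Complex.norm_real, Real.norm_eq_abs,
      abs_of_pos (one_sub_sq_pos z)]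
  have hB : ‖(1 : ℂ) - ((‖b‖ ^ 2 : ℝ) : ℂ)‖ = 1 - ‖b‖ ^ 2 := by
    rw [← Complex.ofReal_one, ← Complex.ofReal_sub, Complex.norm_real, Real.norm_eq_abs,
      abs_of_pos (one_sub_sq_pos (φ z))]
  rw [e5, star_mul_self_eq, star_mul_self_eq, norm_mul, norm_mul, norm_div, norm_div, norm_pow,
    norm_pow, hB, norm_neg, hA, mul_zero, sub_zero, norm_one, one_pow, div_one, sq (1 - ‖b‖ ^ 2),
    div_self_mul_self', inv_mul_le_iff₀ (one_sub_sq_pos (φ z)), mul_one, mul_comm] at hG1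
  exact hG1

theorem comp_mem {φ : 𝔻 → 𝔻} (hφ : IsAnalytic (fun z => (φ z : ℂ))) (f : Bloch) :
    (fun z => f (φ z)) ∈ blochSubmodule := by
  set F : ℂ → ℂ := zeroExt (fun z => (φ z : ℂ)) with hF
  have hFz (z : 𝔻) : F z = φ z := zeroExt_coe _ z
  have hd (z : 𝔻) : HasDerivAt (fun w => zeroExt f (F w))
      (discDeriv f (φ z) * discDeriv (fun z => (φ z : ℂ)) z) z := by
    have h1 : HasDerivAt (zeroExt f) (discDeriv f (φ z)) (F z) := by
      rw [hFz]
      exact f.analytic.hasDerivAt (φ z)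
    exact h1.comp _ (hφ.hasDerivAt z)
  have he (z : 𝔻) : f (φ z) = zeroExt f (F z) := by rw [hFz, zeroExt_coe]
  refine ⟨isAnalytic_of_eq (F := fun w => zeroExt f (F w)) he ?_, ?_⟩
  · intro w hw
    exact (hd (Complex.UnitDisc.mk w (by simpa using hw))).differentiableAt.differentiableWithinAt
  · obtain ⟨A, hA⟩ := f.bddAbove
    refine ⟨A, ?_⟩
    rintro _ ⟨z, rfl⟩
    refine le_trans ?_ (hA ⟨φ z, rfl⟩)
    have hsp := schwarz_pick hφ z
    simp only [weight] at hsp ⊢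
    rw [discDeriv_of_eq (F := fun w => zeroExt f (F w)) he, (hd z).deriv, norm_mul]
    nlinarith [norm_nonneg (discDeriv f (φ z))]

/-- The composition operator `C_φ f = f ∘ φ` on the Bloch space, for an analytic self-map `φ` of the
disc. -/
def compOp (φ : 𝔻 → 𝔻) (hφ : IsAnalytic (fun z => (φ z : ℂ))) : Bloch →ₗ[ℂ] Bloch where
  toFun f := ⟨fun z => f (φ z), comp_mem hφ f⟩
  map_add' _ _ := rfl
  map_smul' _ _ := rfl

theorem pow_mem {φ : 𝔻 → 𝔻} (hφ : IsAnalytic (fun z => (φ z : ℂ))) (n : ℕ) :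
    (fun z => (φ z : ℂ) ^ n) ∈ blochSubmodule := by
  set F : ℂ → ℂ := zeroExt (fun z => (φ z : ℂ)) with hF
  have hFz (z : 𝔻) : F z = φ z := zeroExt_coe _ z
  have he (z : 𝔻) : (φ z : ℂ) ^ n = F z ^ n := by rw [hFz]
  refine ⟨isAnalytic_of_eq (F := fun w => F w ^ n) he (DifferentiableOn.fun_pow hφ n), n, ?_⟩
  rintro _ ⟨z, rfl⟩
  have hsp := schwarz_pick hφ z
  simp only [weight] at hsp ⊢
  rw [discDeriv_of_eq (F := fun w => F w ^ n) he, ((hφ.hasDerivAt z).fun_pow n).deriv, norm_mul,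
    norm_mul, norm_pow, Complex.norm_natCast]
  have h1 : ‖zeroExt (fun z => (φ z : ℂ)) z‖ ^ (n - 1) ≤ 1 := by
    rw [zeroExt_coe]
    exact pow_le_one₀ (norm_nonneg _) (φ z).norm_lt_one.le
  have h2 : (1 - ‖(z : ℂ)‖ ^ 2) * ‖discDeriv (fun z => (φ z : ℂ)) z‖ ≤ 1 := by
    nlinarith [sq_nonneg ‖(φ z : ℂ)‖]
  have h3 := mul_le_one₀ h1 (weight_nonneg (fun z => (φ z : ℂ)) z) h2
  simp only [weight] at h3
  have h4 := mul_le_mul_of_nonneg_left h3 (Nat.cast_nonneg (α := ℝ) n)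
  linarith

/-- The pointwise power `φⁿ` (not an iterate) of an analytic self-map of the disc, as an element of
the Bloch space. -/
def powBloch (φ : 𝔻 → 𝔻) (hφ : IsAnalytic (fun z => (φ z : ℂ))) (n : ℕ) : Bloch :=
  ⟨fun z => (φ z : ℂ) ^ n, pow_mem hφ n⟩

end BlochSpace

end

namespace BlochSpace

/-! Both directions run through Möbius test functions. Expanding `mob a` and its square in powers of
the variable turns norm decay of `c₁ φⁿ + c₂ ψⁿ` into smallness of `c₁ g ∘ φ + c₂ g ∘ ψ` for `g =
mob a` and `g = (mob a)²` as `‖a‖ → 1` (`mobiusVanishing_of_tendsto_pow`).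

If the combination `T` is compact, the monomials, being bounded in the Bloch norm with images
tending pointwise to zero, satisfy `T zⁿ → 0` in norm. Since `C_φ` is not compact, there are points
`z` with `φ z` near the circle and Schwarz–Pick quotient `(1 - |z|²)|φ'(z)| / (1 - |φ(z)|²)` at
least a fixed `δ` (contrapositive of `isCompactOperator_compOp`). Recentre at such a point: `X` and
`Y` are `φ` and `ψ` conjugated by automorphisms so that `X(0) = 0` and `|X'(0)| ≥ δ`. Smallness of
`c₁X' + c₂Y'` and of `c₁XX' + c₂YY'` forces `c₁X'(X - Y)` to be small, hence `X - Y` near the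
origin, hence `X'(0) - Y'(0)`, hence `c₁ + c₂` (`exists_norm_add_mul_le`).

Conversely, take coefficients `1, -1`. Where `φ z` is near the circle, either `ψ z` is
pseudohyperbolically close to it and the test functions control every `f ∘ φ - f ∘ ψ`, or the
quotient of `φ` is small (`weight_combComp_le_or`). The same holds with the roles exchanged, and
`isCompactOperator_of_small` gives compactness. -/

/-! ### Calculus of analytic functions on the disc. -/

theorem IsAnalytic.neg {f : 𝔻 → ℂ} (hf : IsAnalytic f) : IsAnalytic (-f) := by
  simpa using hf.smul (-1)

theorem IsAnalytic.sub {f g : 𝔻 → ℂ} (hf : IsAnalytic f) (hg : IsAnalytic g) :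
    IsAnalytic (f - g) := by
  simpa [sub_eq_add_neg] using hf.add hg.neg

theorem discDeriv_sub {f g : 𝔻 → ℂ} (hf : IsAnalytic f) (hg : IsAnalytic g) (z : 𝔻) :
    discDeriv (f - g) z = discDeriv f z - discDeriv g z := by
  have h := discDeriv_add hf (hg.smul (-1)) z
  rw [discDeriv_smul (-1) hg] at h
  simpa [sub_eq_add_neg] using h

theorem hasDerivAt_zeroExt_comp {f : 𝔻 → ℂ} (hf : IsAnalytic f) {φ : 𝔻 → 𝔻}
    (hφ : IsAnalytic (fun z => (φ z : ℂ))) (z : 𝔻) :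
    HasDerivAt (fun w => zeroExt f (zeroExt (fun z => (φ z : ℂ)) w))
      (discDeriv f (φ z) * discDeriv (fun z => (φ z : ℂ)) z) z := by
  have h1 : HasDerivAt (zeroExt f) (discDeriv f (φ z)) (zeroExt (fun z => (φ z : ℂ)) z) := by
    rw [zeroExt_coe]
    exact hf.hasDerivAt (φ z)
  exact h1.comp _ (hφ.hasDerivAt z)

theorem IsAnalytic.comp {f : 𝔻 → ℂ} (hf : IsAnalytic f) {φ : 𝔻 → 𝔻}
    (hφ : IsAnalytic (fun z => (φ z : ℂ))) : IsAnalytic (fun z => f (φ z)) := by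
  refine isAnalytic_of_eq (F := fun w => zeroExt f (zeroExt (fun z => (φ z : ℂ)) w))
    (fun z => by rw [zeroExt_coe, zeroExt_coe]) fun w hw => ?_
  exact (hasDerivAt_zeroExt_comp hf hφ
    (Complex.UnitDisc.mk w (by simpa using hw))).differentiableAt.differentiableWithinAt

theorem discDeriv_comp {f : 𝔻 → ℂ} (hf : IsAnalytic f) {φ : 𝔻 → 𝔻}
    (hφ : IsAnalytic (fun z => (φ z : ℂ))) (z : 𝔻) :
    discDeriv (fun z => f (φ z)) z = discDeriv f (φ z) * discDeriv (fun z => (φ z : ℂ)) z := by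
  rw [discDeriv_of_eq (F := fun w => zeroExt f (zeroExt (fun z => (φ z : ℂ)) w))
    (fun z => by rw [zeroExt_coe, zeroExt_coe])]
  exact (hasDerivAt_zeroExt_comp hf hφ z).deriv

theorem weight_comp_le {f : 𝔻 → ℂ} (hf : IsAnalytic f) {φ : 𝔻 → 𝔻}
    (hφ : IsAnalytic (fun z => (φ z : ℂ))) (z : 𝔻) :
    weight (fun z => f (φ z)) z ≤ weight f (φ z) := by
  have hsp := schwarz_pick hφ z
  simp only [weight] at hsp ⊢
  rw [discDeriv_comp hf hφ, norm_mul]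
  nlinarith [norm_nonneg (discDeriv f (φ z))]

theorem IsAnalytic.pow {f : 𝔻 → ℂ} (hf : IsAnalytic f) (n : ℕ) :
    IsAnalytic (fun z => f z ^ n) :=
  isAnalytic_of_eq (F := fun w => zeroExt f w ^ n) (fun z => by rw [zeroExt_coe])
    (DifferentiableOn.fun_pow hf n)

theorem discDeriv_pow {f : 𝔻 → ℂ} (hf : IsAnalytic f) (n : ℕ) (z : 𝔻) :
    discDeriv (fun z => f z ^ n) z = n * f z ^ (n - 1) * discDeriv f z := by
  rw [discDeriv_of_eq (F := fun w => zeroExt f w ^ n) (fun z => by rw [zeroExt_coe]),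
    ((hf.hasDerivAt z).fun_pow n).deriv, zeroExt_coe]

theorem exists_coe_eq {w : ℂ} (hw : w ∈ ball (0 : ℂ) 1) : ∃ z : 𝔻, (z : ℂ) = w :=
  ⟨Complex.UnitDisc.mk w (by simpa using hw), rfl⟩

/-! ### Mean value and Cauchy estimates. -/

theorem norm_sub_le_of_discDeriv_le {f : 𝔻 → ℂ} (hf : IsAnalytic f) {r C : ℝ}
    (h : ∀ w : 𝔻, ‖(w : ℂ)‖ ≤ r → ‖discDeriv f w‖ ≤ C) {u v : 𝔻} (hu : ‖(u : ℂ)‖ ≤ r)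
    (hv : ‖(v : ℂ)‖ ≤ r) : ‖f u - f v‖ ≤ C * ‖(u : ℂ) - v‖ := by
  have key := Convex.norm_image_sub_le_of_norm_deriv_le (𝕜 := ℂ) (f := zeroExt f)
    -- The radius `r` may be 1 or more, hence the intersection with the open disc.
    (s := closedBall (0 : ℂ) r ∩ ball 0 1) (C := C) (x := v) (y := u) ?_ ?_
    ((convex_closedBall _ _).inter (convex_ball _ _)) ⟨by simpa using hv, coe_mem_ball v⟩
    ⟨by simpa using hu, coe_mem_ball u⟩
  · simpa only [zeroExt_coe] using key
  · rintro x ⟨-, hx⟩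
    exact hf.differentiableAt (isOpen_ball.mem_nhds hx)
  · rintro x ⟨hx, hx1⟩
    obtain ⟨w, rfl⟩ := exists_coe_eq hx1
    exact h w (by simpa using hx)

theorem norm_discDeriv_le_of_weight_le {f : 𝔻 → ℂ} {w : 𝔻} {M r : ℝ} (hM : weight f w ≤ M)
    (hw : ‖(w : ℂ)‖ ≤ r) (hr : r < 1) : ‖discDeriv f w‖ ≤ M / (1 - r ^ 2) := by
  have h0 := norm_nonneg (w : ℂ)
  have h1 : 0 < 1 - r ^ 2 := by nlinarith
  rw [le_div_iff₀ h1]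
  simp only [weight] at hM
  have h2 : 1 - r ^ 2 ≤ 1 - ‖(w : ℂ)‖ ^ 2 := by nlinarith
  nlinarith [norm_nonneg (discDeriv f w)]

/-- Cauchy's estimate for `f''` on circles of radius `(1 - r) / 2`, which stay in the disc of radius
`(1 + r) / 2`. The point is that `K` depends on `r` only. -/
theorem exists_lipschitz_discDeriv {r : ℝ} (hr0 : 0 ≤ r) (hr : r < 1) :
    ∃ K > 0, ∀ (f : 𝔻 → ℂ) (M : ℝ), IsAnalytic f → (∀ z, weight f z ≤ M) →
      ∀ u v : 𝔻, ‖(u : ℂ)‖ ≤ r → ‖(v : ℂ)‖ ≤ r →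
        ‖discDeriv f u - discDeriv f v‖ ≤ K * M * ‖(u : ℂ) - v‖ := by
  have hR : (1 + r) / 2 < 1 := by linarith
  have hR2 : 0 < 1 - ((1 + r) / 2) ^ 2 := by nlinarith
  refine ⟨1 / (1 - ((1 + r) / 2) ^ 2) / ((1 - r) / 2), by
    have : 0 < (1 - r) / 2 := by linarith
    positivity, fun f M hf hM u v hu hv => ?_⟩
  have hd : DifferentiableOn ℂ (deriv (zeroExt f)) (ball 0 1) := DifferentiableOn.deriv hf isOpen_ball
  refine Convex.norm_image_sub_le_of_norm_deriv_le (𝕜 := ℂ) (f := deriv (zeroExt f))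
    (s := closedBall (0 : ℂ) r) (x := v) (y := u) ?_ ?_
    (convex_closedBall _ _) (by simpa using hv) (by simpa using hu)
  · intro x hx
    refine hd.differentiableAt (isOpen_ball.mem_nhds ?_)
    simp only [mem_closedBall_zero_iff, mem_ball_zero_iff] at hx ⊢
    linarith
  · intro x hx
    have hsub : ∀ y ∈ closedBall x ((1 - r) / 2), ‖y‖ ≤ (1 + r) / 2 := by
      intro y hy
      have h1 : ‖y - x‖ ≤ (1 - r) / 2 := by simpa [dist_eq_norm] using hy
      have h2 : ‖x‖ ≤ r := by simpa using hx
      have h3 : ‖y‖ ≤ ‖y - x‖ + ‖x‖ := by simpa using norm_add_le (y - x) x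
      linarith
    have key := Complex.norm_deriv_le_of_forall_mem_sphere_norm_le (c := x) (R := (1 - r) / 2)
      (C := M / (1 - ((1 + r) / 2) ^ 2)) (f := deriv (zeroExt f)) (by linarith) ?_ ?_
    · refine key.trans_eq ?_
      ring
    · refine DifferentiableOn.diffContOnCl ?_
      refine hd.mono fun y hy => ?_
      rw [closure_ball _ (by linarith)] at hy
      simpa using (hsub y hy).trans_lt hR
    · intro y hy
      have hy' := hsub y (sphere_subset_closedBall hy)
      obtain ⟨w, rfl⟩ := exists_coe_eq (w := y) (by simpa using hy'.trans_lt hR)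
      exact norm_discDeriv_le_of_weight_le (hM w) hy' hR

/-! ### Point evaluations and completeness of the Bloch space. -/

theorem Bloch.weight_le_norm (f : Bloch) (z : 𝔻) : weight f z ≤ ‖f‖ := by
  have h1 : weight f z ≤ f.beta := le_ciSup f.bddAbove z
  have h2 : ‖f‖ = ‖f 0‖ + f.beta := rfl
  linarith [norm_nonneg (f 0)]

theorem Bloch.norm_le {f : Bloch} {A B : ℝ} (hA : ‖f 0‖ ≤ A) (hB : ∀ z, weight f z ≤ B) :
    ‖f‖ ≤ A + B :=
  add_le_add hA (ciSup_le hB)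

theorem Bloch.norm_apply_le (f : Bloch) {z : 𝔻} {r : ℝ} (hz : ‖(z : ℂ)‖ ≤ r) (hr : r < 1) :
    ‖f z‖ ≤ (1 + 1 / (1 - r ^ 2)) * ‖f‖ := by
  have h0 := norm_nonneg (z : ℂ)
  have h1 : 0 < 1 - r ^ 2 := by nlinarith
  have h2 := norm_sub_le_of_discDeriv_le f.analytic (r := r) (u := z) (v := 0)
    (fun w hw => norm_discDeriv_le_of_weight_le (f.weight_le_norm w) hw hr) hz
    (by simpa using h0.trans hz)
  have h3 : ‖f 0‖ ≤ ‖f‖ := le_add_of_nonneg_right f.beta_nonneg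
  have h4 : ‖f z‖ ≤ ‖f z - f 0‖ + ‖f 0‖ := by simpa using norm_add_le (f z - f 0) (f 0)
  simp only [Complex.UnitDisc.coe_zero, sub_zero] at h2
  have h5 : ‖f‖ / (1 - r ^ 2) * ‖(z : ℂ)‖ ≤ ‖f‖ / (1 - r ^ 2) :=
    mul_le_of_le_one_right (by positivity) z.norm_lt_one.le
  have h6 : (1 + 1 / (1 - r ^ 2)) * ‖f‖ = ‖f‖ + ‖f‖ / (1 - r ^ 2) := by ring
  linarith

theorem Bloch.continuous_apply (z : 𝔻) : Continuous fun f : Bloch => f z := by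
  refine (LinearMap.mkContinuous
    (⟨⟨fun f : Bloch => f z, fun _ _ => rfl⟩, fun _ _ => rfl⟩ : Bloch →ₗ[ℂ] ℂ) _
    fun f => f.norm_apply_le le_rfl z.norm_lt_one).continuous

theorem Bloch.coe_sub (f g : Bloch) : ((f - g : Bloch) : 𝔻 → ℂ) = (f : 𝔻 → ℂ) - g := rfl

/-- Point evaluations are bounded uniformly on compact sets, so a Cauchy sequence converges locally
uniformly to an analytic function and its derivatives converge as well. Completeness is what later
turns total boundedness into compactness. -/
instance : CompleteSpace Bloch := by
  refine Metric.complete_of_cauchySeq_tendsto fun u hu => ?_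
  have hlim (z : 𝔻) : ∃ c, Tendsto (fun n => u n z) atTop (𝓝 c) := by
    refine cauchySeq_tendsto_of_complete ?_
    refine Metric.cauchySeq_iff'.2 fun ε hε => ?_
    have hC : 0 < 1 + 1 / (1 - ‖(z : ℂ)‖ ^ 2) := by
      have := one_sub_sq_pos z
      positivity
    obtain ⟨N, hN⟩ := Metric.cauchySeq_iff'.1 hu (ε / (1 + 1 / (1 - ‖(z : ℂ)‖ ^ 2))) (by positivity)
    refine ⟨N, fun n hn => ?_⟩
    have h1 := hN n hn
    rw [dist_eq_norm, lt_div_iff₀' hC] at h1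
    rw [dist_eq_norm]
    exact ((u n - u N).norm_apply_le le_rfl z.norm_lt_one).trans_lt h1
  choose g hg using hlim
  have hloc : TendstoLocallyUniformlyOn (fun n => zeroExt (u n)) (zeroExt g) atTop (ball 0 1) := by
    refine Metric.tendstoLocallyUniformlyOn_iff.2 fun ε hε x hx => ?_
    have hx1 : ‖x‖ < 1 := by simpa using hx
    have hr : (1 + ‖x‖) / 2 < 1 := by linarith
    have hr2 : 0 < 1 - ((1 + ‖x‖) / 2) ^ 2 := by nlinarith [norm_nonneg x]
    refine ⟨ball 0 ((1 + ‖x‖) / 2), mem_nhdsWithin_of_mem_nhds (isOpen_ball.mem_nhds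
      (by simp only [mem_ball_zero_iff]; linarith)), ?_⟩
    set C := 1 + 1 / (1 - ((1 + ‖x‖) / 2) ^ 2)
    have hC : 0 < C := by positivity
    obtain ⟨N, hN⟩ := Metric.cauchySeq_iff.1 hu (ε / 2 / C) (by positivity)
    filter_upwards [eventually_ge_atTop N] with n hn y hy
    have hy1 : ‖y‖ < (1 + ‖x‖) / 2 := by simpa using hy
    obtain ⟨w, rfl⟩ := exists_coe_eq (w := y) (by simpa using hy1.trans hr)
    rw [zeroExt_coe, zeroExt_coe, dist_eq_norm]
    refine lt_of_le_of_lt ?_ (half_lt_self hε)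
    refine le_of_tendsto ((hg w).sub_const (u n w)).norm ?_
    filter_upwards [eventually_ge_atTop N] with m hm
    have h1 := hN m hm n hn
    rw [dist_eq_norm, lt_div_iff₀' hC] at h1
    exact ((u m - u n).norm_apply_le hy1.le hr).trans h1.le
  have hga : IsAnalytic g :=
    hloc.differentiableOn (Eventually.of_forall fun n => (u n).analytic) isOpen_ball
  have hder (z : 𝔻) : Tendsto (fun n => discDeriv (u n) z) atTop (𝓝 (discDeriv g z)) :=
    (hloc.deriv (Eventually.of_forall fun n => (u n).analytic) isOpen_ball).tendsto_at
      (coe_mem_ball z)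
  have hw : ∀ ε > 0, ∃ N, ∀ n ≥ N, ∀ z, weight ((u n : 𝔻 → ℂ) - g) z ≤ ε := by
    intro ε hε
    obtain ⟨N, hN⟩ := Metric.cauchySeq_iff.1 hu ε hε
    refine ⟨N, fun n hn z => ?_⟩
    -- The Cauchy bound passes to the limit in `m` at each fixed `z`, uniformly in `z`.
    have h1 : Tendsto (fun m => weight ((u n : 𝔻 → ℂ) - u m) z) atTop
        (𝓝 (weight ((u n : 𝔻 → ℂ) - g) z)) := by
      simp only [weight, discDeriv_sub (u n).analytic hga,
        discDeriv_sub (u n).analytic (Bloch.analytic _)]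
      exact ((hder z).const_sub _).norm.const_mul _
    refine le_of_tendsto h1 ?_
    filter_upwards [eventually_ge_atTop N] with m hm
    have h2 := hN n hn m hm
    rw [dist_eq_norm] at h2
    exact ((u n - u m).weight_le_norm z).trans h2.le
  have hgb : BddAbove (Set.range (weight g)) := by
    obtain ⟨N, hN⟩ := hw 1 one_pos
    refine ⟨‖u N‖ + 1, ?_⟩
    rintro _ ⟨z, rfl⟩
    have h1 := weight_add_le (u N).analytic (((u N).analytic.sub hga).smul (-1)) z
    rw [weight_smul _ ((u N).analytic.sub hga)] at h1
    have h2 : (u N : 𝔻 → ℂ) + (-1 : ℂ) • ((u N : 𝔻 → ℂ) - g) = g := by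
      simp
    rw [h2] at h1
    have h3 := hN N le_rfl z
    have h4 := (u N).weight_le_norm z
    simp only [norm_neg, norm_one, one_mul] at h1
    linarith
  obtain ⟨G, rfl⟩ : ∃ G : Bloch, (G : 𝔻 → ℂ) = g := ⟨⟨g, hga, hgb⟩, rfl⟩
  refine ⟨G, ?_⟩
  rw [Metric.tendsto_atTop]
  intro ε hε
  obtain ⟨N, hN⟩ := hw (ε / 3) (by positivity)
  obtain ⟨N', hN'⟩ := Metric.tendsto_atTop.1 (hg 0) (ε / 3) (by positivity)
  refine ⟨max N N', fun n hn => ?_⟩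
  rw [dist_eq_norm]
  have h1 := hN' n (le_of_max_le_right hn)
  rw [dist_eq_norm] at h1
  have h2 := Bloch.norm_le (f := u n - G) h1.le (hN n (le_of_max_le_left hn))
  linarith

/-! ### Compactness criteria. -/

/-- A linear operator on the Bloch space is compact as soon as it is small on those functions of
the unit ball of radius two that are small, together with their derivative, on a large disc. -/
theorem isCompactOperator_of_small {T : Bloch →ₗ[ℂ] Bloch}
    (hT : ∀ ε > 0, ∃ r < 1, ∃ δ > 0, ∀ f : Bloch, ‖f‖ ≤ 2 → ‖f 0‖ ≤ δ →
      (∀ w : 𝔻, ‖(w : ℂ)‖ ≤ r → ‖discDeriv f w‖ ≤ δ) → ‖T f‖ ≤ ε) :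
    IsCompactOperator T := by
  rw [isCompactOperator_iff_isCompact_closure_image_ball T one_pos]
  refine isCompact_closure_of_totallyBounded_quasiComplete (𝕜 := ℂ) ?_
  rw [Metric.totallyBounded_iff]
  intro ε hε
  obtain ⟨r₀, hr₀, δ, hδ, H⟩ := hT (ε / 2) (by positivity)
  obtain ⟨r, hr0, hr, hrr⟩ : ∃ r, 0 ≤ r ∧ r < 1 ∧ r₀ ≤ r :=
    ⟨max r₀ 0, le_max_right _ _, max_lt hr₀ one_pos, le_max_left _ _⟩
  obtain ⟨K, hK, hLip⟩ := exists_lipschitz_discDeriv hr0 hr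
  -- With mesh `δ / (4K)`, a function with weight at most 2 has a derivative varying by at most `δ /
  -- 2` between a point and a nearby node.
  obtain ⟨t, hts, htf, htc⟩ := Metric.finite_approx_of_totallyBounded
    (isCompact_closedBall (0 : ℂ) r).totallyBounded (δ / (4 * K)) (by positivity)
  have := htf.fintype
  have htb (y : t) : (y : ℂ) ∈ ball (0 : ℂ) 1 := by
    have := hts y.2
    simp only [mem_closedBall_zero_iff, mem_ball_zero_iff] at this ⊢
    linarith
  choose p hp using fun y : t => exists_coe_eq (htb y)
  -- Finitely many samples: the image of the unit ball is bounded in a finite-dimensional space, so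
  -- a finite net of samples yields a finite net for the image under `T`.
  let L : Bloch → ℂ × (t → ℂ) := fun f => (f 0, fun y => discDeriv f (p y))
  have hL : TotallyBounded (L '' ball 0 1) := by
    suffices h : Bornology.IsBounded (L '' ball 0 1) from
      h.isCompact_closure.totallyBounded.subset subset_closure
    refine isBounded_iff_forall_norm_le.2 ⟨1 + 1 / (1 - r ^ 2), ?_⟩
    rintro _ ⟨f, hf, rfl⟩
    have hf1 : ‖f‖ ≤ 1 := by simpa using (mem_ball_zero_iff.1 hf).le
    have hr2 : 0 < 1 - r ^ 2 := by nlinarith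
    have h0 : ‖f 0‖ ≤ ‖f‖ := le_add_of_nonneg_right f.beta_nonneg
    have hpos : 0 < 1 / (1 - r ^ 2) := by positivity
    refine max_le (by simp only [L]; linarith) ((pi_norm_le_iff_of_nonneg (by positivity)).2 fun y => ?_)
    have h1 : ‖(p y : ℂ)‖ ≤ r := by
      rw [hp]
      simpa using hts y.2
    have h2 := norm_discDeriv_le_of_weight_le ((f.weight_le_norm (p y)).trans hf1) h1 hr
    simp only [L]
    linarith
  obtain ⟨s, hs, hsf, hsc⟩ := Metric.finite_approx_of_totallyBounded hL (δ / 2) (by positivity)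
  have hs' : ∀ y ∈ s, ∃ f : Bloch, f ∈ ball (0 : Bloch) 1 ∧ L f = y := fun y hy => hs hy
  choose! F hF hLF using hs'
  refine ⟨(fun y => T (F y)) '' s, hsf.image _, ?_⟩
  rintro _ ⟨f, hf, rfl⟩
  obtain ⟨y, hy, hfy⟩ := Set.mem_iUnion₂.1 (hsc ⟨f, hf, rfl⟩)
  refine Set.mem_iUnion₂.2 ⟨T (F y), ⟨y, hy, rfl⟩, ?_⟩
  have hf1 : ‖f‖ < 1 := by simpa using hf
  have hF1 : ‖F y‖ < 1 := by simpa using hF y hy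
  rw [← hLF y hy, mem_ball, dist_eq_norm] at hfy
  have hn : ‖f - F y‖ ≤ 2 := (norm_sub_le _ _).trans (by linarith)
  rw [mem_ball, dist_eq_norm, ← map_sub]
  refine lt_of_le_of_lt (H (f - F y) hn ?_ ?_) (half_lt_self hε)
  · have : ‖f 0 - F y 0‖ ≤ ‖L f - L (F y)‖ := norm_fst_le (L f - L (F y))
    change ‖f 0 - F y 0‖ ≤ δ
    linarith
  · intro w hw
    have hwr := hw.trans hrr
    obtain ⟨x, hx, hwx⟩ := Set.mem_iUnion₂.1 (htc (show (w : ℂ) ∈ closedBall 0 r by simpa using hwr))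
    have hxp : ‖(p ⟨x, hx⟩ : ℂ)‖ ≤ r := by
      rw [hp]
      simpa using hts hx
    have h1 := hLip (f - F y : Bloch) 2 (Bloch.analytic _)
      (fun z => ((f - F y).weight_le_norm z).trans hn) w (p ⟨x, hx⟩) hwr hxp
    rw [hp] at h1
    rw [mem_ball, dist_eq_norm, lt_div_iff₀' (by positivity)] at hwx
    have h2 : ‖discDeriv (f - F y : Bloch) (p ⟨x, hx⟩)‖ ≤ δ / 2 := by
      rw [Bloch.coe_sub, discDeriv_sub f.analytic (Bloch.analytic _)]
      exact ((norm_le_pi_norm (L f - L (F y)).2 ⟨x, hx⟩).trans (norm_snd_le _)).trans hfy.le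
    have h3 := norm_add_le (discDeriv (f - F y : Bloch) w - discDeriv (f - F y : Bloch) (p ⟨x, hx⟩))
      (discDeriv (f - F y : Bloch) (p ⟨x, hx⟩))
    rw [sub_add_cancel] at h3
    simp only at h1 hwx
    linarith

/-- The images stay in a compact set, and continuity of point evaluations makes zero their only
possible cluster point. -/
theorem tendsto_zero_of_isCompactOperator {T : Bloch →ₗ[ℂ] Bloch} (hT : IsCompactOperator T)
    {f : ℕ → Bloch} {M : ℝ} (hf : ∀ n, ‖f n‖ ≤ M)
    (h0 : ∀ z, Tendsto (fun n => T (f n) z) atTop (𝓝 0)) :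
    Tendsto (fun n => T (f n)) atTop (𝓝 0) := by
  obtain ⟨K, hK, hTK⟩ := hT.image_closedBall_subset_compact M
  refine hK.tendsto_nhds_of_unique_mapClusterPt
    (Eventually.of_forall fun n => hTK ⟨f n, by simpa using hf n, rfl⟩) fun g _ hg => ?_
  refine Bloch.ext fun z => ?_
  have h1 : MapClusterPt (g z) atTop (fun n => T (f n) z) :=
    hg.continuousAt_comp (Bloch.continuous_apply z).continuousAt
  exact eq_of_nhds_neBot (h1.neBot.mono (inf_le_inf_left _ (h0 z)))

/-! ### Disc automorphisms. -/

/-- The automorphism `w ↦ (w - a) / (1 - conj a * w)` of the disc. -/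
noncomputable def mob (a w : 𝔻) : 𝔻 :=
  Complex.UnitDisc.mk (((w : ℂ) - a) / (1 - star (a : ℂ) * w))
    (norm_mobius_lt a.norm_lt_one w.norm_lt_one).2

theorem coe_mob (a w : 𝔻) : (mob a w : ℂ) = ((w : ℂ) - a) / (1 - star (a : ℂ) * w) := rfl

theorem one_sub_star_mul_ne_zero (a w : 𝔻) : 1 - star (a : ℂ) * w ≠ 0 :=
  (norm_mobius_lt a.norm_lt_one w.norm_lt_one).1

theorem isAnalytic_mob (a : 𝔻) : IsAnalytic (fun w => (mob a w : ℂ)) := by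
  refine isAnalytic_of_eq (F := fun w => (w - a) / (1 - star (a : ℂ) * w)) (fun w => rfl) ?_
  intro w hw
  obtain ⟨v, rfl⟩ := exists_coe_eq hw
  exact (hasDerivAt_mobius (one_sub_star_mul_ne_zero a v)).differentiableAt.differentiableWithinAt

theorem discDeriv_mob (a w : 𝔻) : discDeriv (fun w => (mob a w : ℂ)) w =
    (1 - star (a : ℂ) * a) / (1 - star (a : ℂ) * w) ^ 2 := by
  rw [discDeriv_of_eq (F := fun w => (w - a) / (1 - star (a : ℂ) * w)) (coe_mob a)]
  exact (hasDerivAt_mobius (one_sub_star_mul_ne_zero a w)).deriv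

theorem mob_self (a : 𝔻) : mob a a = 0 :=
  Complex.UnitDisc.coe_injective (by simp [coe_mob])

theorem mob_zero (a : 𝔻) : mob a 0 = -a :=
  Complex.UnitDisc.coe_injective (by simp [coe_mob])

theorem mob_neg_mob (a w : 𝔻) : mob (-a) (mob a w) = w := by
  refine Complex.UnitDisc.coe_injective ?_
  have h1 := one_sub_star_mul_ne_zero a w
  have h2 := one_sub_star_mul_ne_zero (-a) (mob a w)
  have h3 := one_sub_star_mul_ne_zero a a
  rw [coe_mob, div_eq_iff h2, coe_mob]
  simp only [Complex.UnitDisc.coe_neg, star_neg]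
  generalize star (a : ℂ) = s at *
  have h4 : 1 - (w : ℂ) * s ≠ 0 := by rwa [mul_comm]
  field_simp
  ring

theorem isAnalytic_coe : IsAnalytic (fun w : 𝔻 => (w : ℂ)) :=
  isAnalytic_of_eq (F := id) (fun _ => rfl) differentiableOn_id

theorem discDeriv_coe (z : 𝔻) : discDeriv (fun w : 𝔻 => (w : ℂ)) z = 1 := by
  rw [discDeriv_of_eq (F := fun w => w) (fun _ => rfl)]
  exact deriv_id _

/-! ### Combinations of two compositions. -/

/-- The function `c₁ g ∘ φ + c₂ g ∘ ψ`. -/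
def combComp (c₁ c₂ : ℂ) (φ ψ : 𝔻 → 𝔻) (g : 𝔻 → ℂ) : 𝔻 → ℂ :=
  fun z => c₁ * g (φ z) + c₂ * g (ψ z)

section CombComp

variable {c₁ c₂ : ℂ} {φ ψ : 𝔻 → 𝔻} {g : 𝔻 → ℂ}

theorem isAnalytic_combComp (hφ : IsAnalytic (fun z => (φ z : ℂ)))
    (hψ : IsAnalytic (fun z => (ψ z : ℂ))) (hg : IsAnalytic g) :
    IsAnalytic (combComp c₁ c₂ φ ψ g) :=
  ((hg.comp hφ).smul c₁).add ((hg.comp hψ).smul c₂)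

theorem discDeriv_combComp (hφ : IsAnalytic (fun z => (φ z : ℂ)))
    (hψ : IsAnalytic (fun z => (ψ z : ℂ))) (hg : IsAnalytic g) (z : 𝔻) :
    discDeriv (combComp c₁ c₂ φ ψ g) z =
      c₁ * (discDeriv g (φ z) * discDeriv (fun z => (φ z : ℂ)) z) +
        c₂ * (discDeriv g (ψ z) * discDeriv (fun z => (ψ z : ℂ)) z) := by
  have h := discDeriv_add ((hg.comp hφ).smul c₁) ((hg.comp hψ).smul c₂) z
  rw [discDeriv_smul _ (hg.comp hφ), discDeriv_smul _ (hg.comp hψ), discDeriv_comp hg hφ,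
    discDeriv_comp hg hψ] at h
  exact h

theorem weight_eq_norm (f : 𝔻 → ℂ) (z : 𝔻) :
    weight f z = ‖((1 - ‖(z : ℂ)‖ ^ 2 : ℝ) : ℂ) * discDeriv f z‖ := by
  rw [norm_mul, Complex.norm_real, Real.norm_eq_abs, abs_of_pos (one_sub_sq_pos z), weight]

/-- Attaching the factor `1 - |z|²` to the derivatives of `φ` and `ψ` leaves an expression linear in
two complex numbers that do not depend on `g`. -/
theorem weight_combComp (hφ : IsAnalytic (fun z => (φ z : ℂ)))
    (hψ : IsAnalytic (fun z => (ψ z : ℂ))) (hg : IsAnalytic g) (z : 𝔻) :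
    weight (combComp c₁ c₂ φ ψ g) z =
      ‖c₁ * (discDeriv g (φ z) *
          (((1 - ‖(z : ℂ)‖ ^ 2 : ℝ) : ℂ) * discDeriv (fun z => (φ z : ℂ)) z)) +
        c₂ * (discDeriv g (ψ z) *
          (((1 - ‖(z : ℂ)‖ ^ 2 : ℝ) : ℂ) * discDeriv (fun z => (ψ z : ℂ)) z))‖ := by
  rw [weight_eq_norm, discDeriv_combComp hφ hψ hg]
  congr 1
  ring

end CombComp

/-! ### From powers to Möbius test functions. -/

/-- Weighted averages of a null sequence with weights `(n + k).choose k * t ^ n` tend to zero as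
`t` tends to one. -/
theorem exists_choose_mul_geometric_average_le {e : ℕ → ℝ} (he : ∀ n, 0 ≤ e n)
    (hlim : Tendsto e atTop (𝓝 0)) (k : ℕ) {ε : ℝ} (hε : 0 < ε) :
    ∃ r < 1, ∀ t, r < t → 0 ≤ t → t < 1 →
      Summable (fun n => ((n + k).choose k : ℝ) * t ^ n * e n) ∧
        (1 - t) ^ (k + 1) * ∑' n, ((n + k).choose k : ℝ) * t ^ n * e n ≤ ε := by
  obtain ⟨M, hM⟩ := hlim.bddAbove_range
  have hM' (n) : e n ≤ M := hM ⟨n, rfl⟩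
  have hM0 : 0 ≤ M := (he 0).trans (hM' 0)
  obtain ⟨N, hN⟩ := eventually_atTop.1 (hlim.eventually_le_const (half_pos hε))
  set B : ℝ := ∑ n ∈ Finset.range N, ((n + k).choose k : ℝ) * M with hB
  have hB0 : 0 ≤ B := Finset.sum_nonneg fun n _ => by positivity
  -- Beyond this threshold the first `N` terms contribute at most `(1 - t) B ≤ ε / 2`; the tail is
  -- at most `ε / 2` by the binomial series.
  refine ⟨1 - ε / (2 * (B + 1)), by linarith [show 0 < ε / (2 * (B + 1)) by positivity],
    fun t hrt ht0 ht1 => ?_⟩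
  have h1t : 0 < 1 - t := sub_pos.2 ht1
  have hgeo := (hasSum_choose_mul_geometric_of_norm_lt_one k (r := t)
    (by rwa [Real.norm_eq_abs, abs_of_nonneg ht0])).mul_left (ε / 2)
  have hfin : HasSum (fun n => if n ∈ Finset.range N then ((n + k).choose k : ℝ) * M else 0) B := by
    rw [hB, ← Finset.sum_congr rfl (fun n hn => if_pos hn)]
    exact hasSum_sum_of_ne_finset_zero fun n hn => if_neg hn
  have hsum := hgeo.add hfin
  have hle (n : ℕ) : ((n + k).choose k : ℝ) * t ^ n * e n ≤
      ε / 2 * (((n + k).choose k : ℝ) * t ^ n) +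
        if n ∈ Finset.range N then ((n + k).choose k : ℝ) * M else 0 := by
    have hc : (0 : ℝ) ≤ ((n + k).choose k : ℝ) := by positivity
    have hct : 0 ≤ ((n + k).choose k : ℝ) * t ^ n := by positivity
    split_ifs with h
    · have h1 : t ^ n ≤ 1 := pow_le_one₀ ht0 ht1.le
      have h2 : ((n + k).choose k : ℝ) * t ^ n * e n ≤ ((n + k).choose k : ℝ) * 1 * M := by
        gcongr
        · exact he n
        · exact hM' n
      have h3 : 0 ≤ ε / 2 * (((n + k).choose k : ℝ) * t ^ n) := by positivity
      linarith
    · have h1 := hN n (by simpa using h)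
      nlinarith
  have hs : Summable (fun n => ((n + k).choose k : ℝ) * t ^ n * e n) :=
    Summable.of_nonneg_of_le (fun n => by have := he n; positivity) hle hsum.summable
  refine ⟨hs, ?_⟩
  have h1 : ∑' n, ((n + k).choose k : ℝ) * t ^ n * e n ≤ _ := hasSum_le hle hs.hasSum hsum
  have h2 : (1 - t) ^ (k + 1) * B ≤ ε / 2 := by
    have h3 : (1 - t) ^ (k + 1) ≤ 1 - t := by
      simpa using pow_le_pow_of_le_one h1t.le (by linarith) (Nat.succ_le_succ (Nat.zero_le k))
    have h4 : 1 - t < ε / (2 * (B + 1)) := by linarith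
    rw [lt_div_iff₀ (by positivity)] at h4
    nlinarith
  calc (1 - t) ^ (k + 1) * ∑' n, ((n + k).choose k : ℝ) * t ^ n * e n
      ≤ (1 - t) ^ (k + 1) * (ε / 2 * (1 / (1 - t) ^ (k + 1)) + B) := by gcongr
    _ = ε / 2 + (1 - t) ^ (k + 1) * B := by field_simp
    _ ≤ ε := by linarith

/-- The functions `c₁ g ∘ φ + c₂ g ∘ ψ` tend to zero in the Bloch seminorm if `g` runs through the
disc automorphisms `mob a` and their squares and `‖a‖` tends to one. -/
def MobiusVanishing (c₁ c₂ : ℂ) (φ ψ : 𝔻 → 𝔻) : Prop :=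
  ∀ ε > 0, ∃ r < 1, ∀ a : 𝔻, r < ‖(a : ℂ)‖ → ∀ z,
    weight (combComp c₁ c₂ φ ψ (fun w => (mob a w : ℂ))) z ≤ ε ∧
      weight (combComp c₁ c₂ φ ψ (fun w => (mob a w : ℂ) ^ 2)) z ≤ ε

theorem mobiusVanishing_of_tendsto_pow {c₁ c₂ : ℂ} {φ ψ : 𝔻 → 𝔻}
    (hφ : IsAnalytic (fun z => (φ z : ℂ))) (hψ : IsAnalytic (fun z => (ψ z : ℂ)))
    (h : Tendsto (fun n => ‖c₁ • powBloch φ hφ n + c₂ • powBloch ψ hψ n‖) atTop (𝓝 0)) :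
    MobiusVanishing c₁ c₂ φ ψ := by
  intro ε hε
  set e : ℕ → ℝ := fun n => ‖c₁ • powBloch φ hφ n + c₂ • powBloch ψ hψ n‖ with he
  obtain ⟨r₀, hr₀, H₀⟩ := exists_choose_mul_geometric_average_le (e := fun n => e (n + 1))
    (fun n => norm_nonneg _) (h.comp (tendsto_add_atTop_nat 1)) 0 (ε := ε / 12) (by positivity)
  obtain ⟨r₁, hr₁, H₁⟩ := exists_choose_mul_geometric_average_le (e := fun n => e (n + 2))
    (fun n => norm_nonneg _) (h.comp (tendsto_add_atTop_nat 2)) 1 (ε := ε / 12) (by positivity)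
  refine ⟨max r₀ r₁, max_lt hr₀ hr₁, fun a ha z => ?_⟩
  obtain ⟨S₀, B₀⟩ := H₀ _ ((le_max_left _ _).trans_lt ha) (norm_nonneg _) a.norm_lt_one
  obtain ⟨S₁, B₁⟩ := H₁ _ ((le_max_right _ _).trans_lt ha) (norm_nonneg _) a.norm_lt_one
  set t : ℝ := ‖(a : ℂ)‖ with ht
  have ht0 : 0 ≤ t := norm_nonneg _
  have ht1 : t < 1 := a.norm_lt_one
  have hsq : IsAnalytic (fun w => (mob a w : ℂ) ^ 2) := (isAnalytic_mob a).pow 2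
  rw [weight_combComp hφ hψ (isAnalytic_mob a), weight_combComp hφ hψ hsq,
    discDeriv_pow (isAnalytic_mob a), discDeriv_pow (isAnalytic_mob a), discDeriv_mob,
    discDeriv_mob]
  have hS (n : ℕ) : weight (combComp c₁ c₂ φ ψ (fun w => (w : ℂ) ^ n)) z ≤ e n :=
    (c₁ • powBloch φ hφ n + c₂ • powBloch ψ hψ n).weight_le_norm z
  simp only [weight_combComp hφ hψ (isAnalytic_coe.pow _), discDeriv_pow isAnalytic_coe,
    discDeriv_coe, mul_one] at hS
  set P := ((1 - ‖(z : ℂ)‖ ^ 2 : ℝ) : ℂ) * discDeriv (fun z => (φ z : ℂ)) z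
  set Q := ((1 - ‖(z : ℂ)‖ ^ 2 : ℝ) : ℂ) * discDeriv (fun z => (ψ z : ℂ)) z
  set u : ℂ := (φ z : ℂ) with hu
  set v : ℂ := (ψ z : ℂ) with hv
  set b : ℂ := star (a : ℂ) with hb
  have hbt : ‖b‖ = t := norm_star _
  have hub : ‖b * u‖ < 1 := by
    rw [norm_mul, hbt]
    nlinarith [(φ z).norm_lt_one, norm_nonneg u]
  have hvb : ‖b * v‖ < 1 := by
    rw [norm_mul, hbt]
    nlinarith [(ψ z).norm_lt_one, norm_nonneg v]
  have hu1 : 1 - b * u ≠ 0 := one_sub_star_mul_ne_zero a (φ z)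
  have hv1 : 1 - b * v ≠ 0 := one_sub_star_mul_ne_zero a (ψ z)
  -- `1 / (1 - bu)² = ∑ (n + 1) bⁿ uⁿ`, and `(n + 1) uⁿ` is the derivative of the power `n + 1`;
  -- hence the shift in `e`.
  have N₀ : ‖c₁ * P * (1 / (1 - b * u) ^ 2) + c₂ * Q * (1 / (1 - b * v) ^ 2)‖ ≤
      ∑' n, ((n + 0).choose 0 : ℝ) * t ^ n * e (n + 1) := by
    refine (((hasSum_choose_mul_geometric_of_norm_lt_one 1 hub).mul_left (c₁ * P)).add
      ((hasSum_choose_mul_geometric_of_norm_lt_one 1 hvb).mul_left (c₂ * Q))).norm_le_of_bounded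
      S₀.hasSum fun n => ?_
    have h1 := mul_le_mul_of_nonneg_left (hS (n + 1)) (pow_nonneg ht0 n)
    rw [← hbt, ← norm_pow, ← norm_mul, norm_pow, hbt] at h1
    simp only [add_zero, Nat.choose_zero_right, Nat.cast_one, one_mul]
    refine le_trans (le_of_eq ?_) h1
    congr 1
    simp only [Nat.choose_one_right, Nat.add_sub_cancel]
    push_cast
    ring
  -- `u / (1 - bu)³ = ∑ (n + 2).choose 2 * bⁿ uⁿ⁺¹`, which is `(n + 1) bⁿ / 2` times the derivative
  -- of the power `n + 2`.
  have N₁ : ‖c₁ * P * u * (1 / (1 - b * u) ^ 3) + c₂ * Q * v * (1 / (1 - b * v) ^ 3)‖ ≤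
      ∑' n, ((n + 1).choose 1 : ℝ) * t ^ n * e (n + 2) := by
    refine (((hasSum_choose_mul_geometric_of_norm_lt_one 2 hub).mul_left (c₁ * P * u)).add
      ((hasSum_choose_mul_geometric_of_norm_lt_one 2 hvb).mul_left (c₂ * Q * v))).norm_le_of_bounded
      S₁.hasSum fun n => ?_
    have h2 : ‖((n + 1 : ℕ) : ℂ) * b ^ n / 2‖ ≤ ((n + 1 : ℕ) : ℝ) * t ^ n := by
      rw [norm_div, norm_mul, norm_pow, hbt, Complex.norm_natCast]
      have : 0 ≤ ((n + 1 : ℕ) : ℝ) * t ^ n := by positivity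
      simp only [Complex.norm_ofNat]
      linarith
    have h1 := mul_le_mul h2 (hS (n + 2)) (norm_nonneg _) (by positivity)
    rw [← norm_mul] at h1
    rw [Nat.choose_one_right]
    refine le_trans (le_of_eq ?_) h1
    congr 1
    simp only [Nat.cast_choose_two, show n + 2 - 1 = n + 1 from rfl]
    push_cast
    ring
  have hA : ‖1 - b * a‖ ≤ 2 * (1 - t) := by
    rw [hb, star_mul_self_eq, ← Complex.ofReal_one, ← Complex.ofReal_sub, Complex.norm_real,
      Real.norm_eq_abs, abs_of_pos (one_sub_sq_pos a)]
    nlinarith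
  set s₀ := c₁ * P * (1 / (1 - b * u) ^ 2) + c₂ * Q * (1 / (1 - b * v) ^ 2) with hs₀
  set s₁ := c₁ * P * u * (1 / (1 - b * u) ^ 3) + c₂ * Q * v * (1 / (1 - b * v) ^ 3) with hs₁
  have M₀ : ‖(1 - b * a) * s₀‖ ≤ ε / 6 := by
    rw [norm_mul]
    calc ‖1 - b * a‖ * ‖s₀‖ ≤ 2 * (1 - t) * ∑' n, ((n + 0).choose 0 : ℝ) * t ^ n * e (n + 1) := by
          gcongr
      _ = 2 * ((1 - t) ^ (0 + 1) * ∑' n, ((n + 0).choose 0 : ℝ) * t ^ n * e (n + 1)) := by ring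
      _ ≤ ε / 6 := by linarith
  have M₁ : ‖(1 - b * a) ^ 2 * s₁‖ ≤ ε / 3 := by
    rw [norm_mul, norm_pow]
    calc ‖1 - b * a‖ ^ 2 * ‖s₁‖ ≤
        (2 * (1 - t)) ^ 2 * ∑' n, ((n + 1).choose 1 : ℝ) * t ^ n * e (n + 2) := by
          gcongr
      _ = 4 * ((1 - t) ^ (1 + 1) * ∑' n, ((n + 1).choose 1 : ℝ) * t ^ n * e (n + 2)) := by ring
      _ ≤ ε / 3 := by linarith
  constructor
  · refine le_trans (le_of_eq ?_) (M₀.trans (by linarith))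
    congr 1
    rw [hs₀]
    ring
  -- This form splits `mob a * (mob a)'` into `-a (1 - ba) / (1 - bw)²` and `(1 - ba)² w / (1 -
  -- bw)³`, matching `s₀` and `s₁`.
  · have hmob (w : 𝔻) : (mob a w : ℂ) = -a + (1 - b * a) * (w / (1 - b * w)) := by
      have h1 : 1 - b * w ≠ 0 := one_sub_star_mul_ne_zero a w
      have h2 : 1 - (w : ℂ) * b ≠ 0 := by rwa [mul_comm]
      rw [coe_mob, ← hb]
      field_simp
      ring
    have h3 : ‖-(a : ℂ) * ((1 - b * a) * s₀) + (1 - b * a) ^ 2 * s₁‖ ≤ ε / 2 := by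
      refine (norm_add_le _ _).trans ?_
      rw [norm_mul, norm_neg]
      have := mul_le_of_le_one_left (norm_nonneg ((1 - b * a) * s₀)) a.norm_lt_one.le
      linarith
    have h4 : ‖2 * (-(a : ℂ) * ((1 - b * a) * s₀) + (1 - b * a) ^ 2 * s₁)‖ ≤ ε := by
      rw [norm_mul, Complex.norm_ofNat]
      linarith
    refine le_trans (le_of_eq ?_) h4
    congr 1
    rw [hmob, hmob, hs₀, hs₁, ← hu, ← hv]
    push_cast
    simp only [pow_one]
    field_simp
    ring

/-! ### Vanishing of the coefficient sum. -/

theorem weight_comp {f : 𝔻 → ℂ} (hf : IsAnalytic f) {φ : 𝔻 → 𝔻}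
    (hφ : IsAnalytic (fun z => (φ z : ℂ))) (z : 𝔻) :
    weight (fun z => f (φ z)) z = ‖discDeriv f (φ z)‖ * weight (fun z => (φ z : ℂ)) z := by
  simp only [weight]
  rw [discDeriv_comp hf hφ, norm_mul]
  ring

theorem weight_coe_le_one {φ : 𝔻 → 𝔻} (hφ : IsAnalytic (fun z => (φ z : ℂ))) (z : 𝔻) :
    weight (fun z => (φ z : ℂ)) z ≤ 1 :=
  (schwarz_pick hφ z).trans (by linarith [sq_nonneg ‖(φ z : ℂ)‖])

/-- If `c₁ X + c₂ Y` and `c₁ X² + c₂ Y²` are small in the Bloch seminorm while `X'(0)` is not, then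
`c₁ + c₂` is small. -/
theorem exists_norm_add_mul_le {c₁ : ℂ} (c₂ : ℂ) {δ : ℝ} (hc₁ : c₁ ≠ 0) (hδ : 0 < δ) :
    ∃ C > 0, ∀ (ε : ℝ) (X Y : 𝔻 → ℂ), IsAnalytic X → IsAnalytic Y → (∀ z, weight X z ≤ 1) →
      (∀ z, ‖Y z‖ ≤ 1) → δ ≤ ‖discDeriv X 0‖ →
      (∀ z, weight (fun z => c₁ * X z + c₂ * Y z) z ≤ ε) →
      (∀ z, weight (fun z => c₁ * X z ^ 2 + c₂ * Y z ^ 2) z ≤ ε) → ‖c₁ + c₂‖ * δ ≤ C * ε := by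
  obtain ⟨K, hK, hLip⟩ := exists_lipschitz_discDeriv (r := 1 / 2) (by norm_num) (by norm_num)
  -- On the disc of radius `ρ` the derivative of `X` keeps modulus at least `δ / 2`.
  obtain ⟨ρ, hρ, hρ2, hρK⟩ : ∃ ρ > 0, ρ ≤ 1 / 2 ∧ K * ρ ≤ δ / 2 := by
    refine ⟨min (1 / 2) (δ / 2 / K), by positivity, min_le_left _ _, ?_⟩
    rw [← le_div_iff₀' hK]
    exact min_le_right _ _
  have hc : 0 < ‖c₁‖ := norm_pos_iff.2 hc₁
  refine ⟨4 / 3 + ‖c₂‖ * (4 / (‖c₁‖ * δ) / ρ), by positivity,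
    fun ε X Y hX hY hX1 hY1 hX0 h1 h2 => ?_⟩
  have d1 (z : 𝔻) : discDeriv (fun z => c₁ * X z + c₂ * Y z) z =
      c₁ * discDeriv X z + c₂ * discDeriv Y z := by
    rw [← discDeriv_smul _ hX, ← discDeriv_smul _ hY, ← discDeriv_add (hX.smul _) (hY.smul _)]
    rfl
  have d2 (z : 𝔻) : discDeriv (fun z => c₁ * X z ^ 2 + c₂ * Y z ^ 2) z =
      2 * (c₁ * X z * discDeriv X z + c₂ * Y z * discDeriv Y z) := by
    have h := discDeriv_add ((hX.pow 2).smul c₁) ((hY.pow 2).smul c₂) z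
    rw [discDeriv_smul _ (hX.pow 2), discDeriv_smul _ (hY.pow 2), discDeriv_pow hX,
      discDeriv_pow hY] at h
    refine Eq.trans h ?_
    push_cast
    simp only [pow_one]
    ring
  have hclose (z : 𝔻) (hz : ‖(z : ℂ)‖ ≤ ρ) : ‖X z - Y z‖ ≤ 4 / (‖c₁‖ * δ) * ε := by
    have hz2 := hz.trans hρ2
    have e1 := norm_discDeriv_le_of_weight_le (h1 z) hz2 (by norm_num)
    have e2 := norm_discDeriv_le_of_weight_le (h2 z) hz2 (by norm_num)
    rw [d1] at e1
    rw [d2, norm_mul, Complex.norm_ofNat] at e2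
    have e3 := hLip X 1 hX hX1 0 z (by simp) hz2
    simp only [Complex.UnitDisc.coe_zero, zero_sub, norm_neg, mul_one] at e3
    have e4 : δ / 2 ≤ ‖discDeriv X z‖ := by
      have h4 := norm_sub_norm_le (discDeriv X 0) (discDeriv X z)
      have h5 : K * ‖(z : ℂ)‖ ≤ K * ρ := by gcongr
      linarith
    -- Eliminating `Y'` between the two small combinations isolates `X - Y`.
    have e5 : c₁ * discDeriv X z * (X z - Y z) =
        (c₁ * X z * discDeriv X z + c₂ * Y z * discDeriv Y z) -
          Y z * (c₁ * discDeriv X z + c₂ * discDeriv Y z) := by ring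
    have e6 := norm_sub_le (c₁ * X z * discDeriv X z + c₂ * Y z * discDeriv Y z)
      (Y z * (c₁ * discDeriv X z + c₂ * discDeriv Y z))
    rw [← e5, norm_mul, norm_mul, norm_mul] at e6
    have e7 := mul_le_of_le_one_left (norm_nonneg (c₁ * discDeriv X z + c₂ * discDeriv Y z)) (hY1 z)
    have e8 : ‖c₁‖ * (δ / 2) * ‖X z - Y z‖ ≤ ‖c₁‖ * ‖discDeriv X z‖ * ‖X z - Y z‖ := by gcongr
    have e9 : ε / (1 - (1 / 2 : ℝ) ^ 2) = 4 / 3 * ε := by ring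
    rw [e9] at e1 e2
    rw [div_mul_eq_mul_div, le_div_iff₀ (by positivity)]
    linarith
  -- Cauchy's estimate on the circle of radius `ρ`.
  have hder : ‖discDeriv X 0 - discDeriv Y 0‖ ≤ 4 / (‖c₁‖ * δ) * ε / ρ := by
    rw [← discDeriv_sub hX hY]
    have hsub : closedBall (0 : ℂ) ρ ⊆ ball 0 1 := closedBall_subset_ball (by linarith)
    refine Complex.norm_deriv_le_of_forall_mem_sphere_norm_le hρ ?_ fun w hw => ?_
    · refine DifferentiableOn.diffContOnCl (DifferentiableOn.mono (hX.sub hY) ?_)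
      rw [Complex.UnitDisc.coe_zero, closure_ball _ hρ.ne']
      exact hsub
    · have hw' : ‖w‖ ≤ ρ := by simpa using (mem_sphere_zero_iff_norm.1 hw).le
      obtain ⟨z, rfl⟩ := exists_coe_eq (w := w) (hsub (by simpa using hw'))
      rw [zeroExt_coe]
      exact hclose z hw'
  have e1 := norm_discDeriv_le_of_weight_le (h1 0) (r := 1 / 2) (by simp) (by norm_num)
  rw [d1] at e1
  have e2 : (c₁ + c₂) * discDeriv X 0 = (c₁ * discDeriv X 0 + c₂ * discDeriv Y 0) +
      c₂ * (discDeriv X 0 - discDeriv Y 0) := by ring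
  have e3 := norm_add_le (c₁ * discDeriv X 0 + c₂ * discDeriv Y 0)
    (c₂ * (discDeriv X 0 - discDeriv Y 0))
  rw [← e2, norm_mul, norm_mul] at e3
  calc ‖c₁ + c₂‖ * δ ≤ ‖c₁ + c₂‖ * ‖discDeriv X 0‖ := by gcongr
    _ ≤ ε / (1 - (1 / 2) ^ 2) + ‖c₂‖ * (4 / (‖c₁‖ * δ) * ε / ρ) := by
      refine e3.trans (add_le_add e1 ?_)
      gcongr
    _ = _ := by ring

/-- With `a = φ z`, set `X = mob a ∘ φ ∘ mob (-z)` and `Y = mob a ∘ ψ ∘ mob (-z)`. Then `|X'(0)|` is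
the Schwarz–Pick quotient of `φ` at `z`, and precomposing with `mob (-z)` does not spoil the bounds
on the weights. -/
theorem MobiusVanishing.add_eq_zero {c₁ c₂ : ℂ} {φ ψ : 𝔻 → 𝔻} (h : MobiusVanishing c₁ c₂ φ ψ)
    (hφ : IsAnalytic (fun z => (φ z : ℂ))) (hψ : IsAnalytic (fun z => (ψ z : ℂ))) (hc₁ : c₁ ≠ 0)
    {δ : ℝ} (hδ : 0 < δ) (H : ∀ r < 1, ∃ z, r < ‖(φ z : ℂ)‖ ∧
      δ * (1 - ‖(φ z : ℂ)‖ ^ 2) ≤ weight (fun z => (φ z : ℂ)) z) : c₁ + c₂ = 0 := by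
  obtain ⟨C, hC, hX⟩ := exists_norm_add_mul_le c₂ hc₁ hδ
  suffices hsmall : ∀ ε > 0, ‖c₁ + c₂‖ * δ ≤ 0 + ε by
    have h0 := le_of_forall_pos_le_add hsmall
    exact norm_eq_zero.1 (le_antisymm (by nlinarith) (norm_nonneg _))
  intro ε hε
  obtain ⟨r, hr, hv⟩ := h (ε / C) (by positivity)
  obtain ⟨z, hzr, hzδ⟩ := H r hr
  have hz (w : 𝔻) := hv (φ z) hzr w
  set a := φ z with ha
  have hτ := isAnalytic_mob (-z)
  have hσφ : IsAnalytic (fun w => (mob a (φ w) : ℂ)) := (isAnalytic_mob a).comp hφ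
  have hσψ : IsAnalytic (fun w => (mob a (ψ w) : ℂ)) := (isAnalytic_mob a).comp hψ
  have hAX : IsAnalytic (fun w => (mob a (φ (mob (-z) w)) : ℂ)) := hσφ.comp hτ
  have hAY : IsAnalytic (fun w => (mob a (ψ (mob (-z) w)) : ℂ)) := hσψ.comp hτ
  have key := hX (ε / C) _ _ hAX hAY (weight_coe_le_one hAX)
    (fun w => (Complex.UnitDisc.norm_lt_one _).le) ?_ ?_ ?_
  · rw [mul_div_cancel₀ _ hC.ne'] at key
    linarith
  · have e1 := discDeriv_comp hσφ hτ 0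
    rw [discDeriv_comp (isAnalytic_mob a) hφ, discDeriv_mob, discDeriv_mob, mob_zero, neg_neg,
      ← ha, Complex.UnitDisc.coe_zero, mul_zero, sub_zero, one_pow, div_one,
      star_mul_self_eq, star_mul_self_eq, Complex.UnitDisc.coe_neg, norm_neg] at e1
    rw [e1]
    have ha0 := one_sub_sq_pos a
    have hz0 := one_sub_sq_pos z
    have e2 (x : ℝ) : (1 : ℂ) - (x : ℂ) = ((1 - x : ℝ) : ℂ) := by push_cast; rfl
    rw [e2, e2, norm_mul, norm_mul, norm_div, norm_pow, Complex.norm_real, Complex.norm_real,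
      Real.norm_eq_abs, Real.norm_eq_abs, abs_of_pos ha0, abs_of_pos hz0]
    rw [← le_div_iff₀ ha0] at hzδ
    refine hzδ.trans_eq ?_
    simp only [weight]
    field_simp
  · exact fun w => (weight_comp_le (isAnalytic_combComp hφ hψ (isAnalytic_mob a)) hτ w).trans
      (hz _).1
  · exact fun w => (weight_comp_le (isAnalytic_combComp hφ hψ ((isAnalytic_mob a).pow 2)) hτ
      w).trans (hz _).2

/-! ### Compactness of one composition operator and of a difference. -/

/-- Where `φ z` stays away from the circle, `f'(φ z)` is small; elsewhere the quotient of `φ` is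
small and the weight of `f` is bounded. -/
theorem isCompactOperator_compOp {φ : 𝔻 → 𝔻} (hφ : IsAnalytic (fun z => (φ z : ℂ)))
    (H : ∀ δ > 0, ∃ r < 1, ∀ z, r < ‖(φ z : ℂ)‖ →
      weight (fun z => (φ z : ℂ)) z < δ * (1 - ‖(φ z : ℂ)‖ ^ 2)) :
    IsCompactOperator (compOp φ hφ) := by
  refine isCompactOperator_of_small fun ε hε => ?_
  obtain ⟨r, hr, h⟩ := H (ε / 8) (by positivity)
  refine ⟨max r ‖(φ 0 : ℂ)‖, max_lt hr (φ 0).norm_lt_one, ε / 8, by positivity,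
    fun f hf hf0 hfr => ?_⟩
  have h0 : ‖f (φ 0)‖ ≤ ε / 4 := by
    have h1 := norm_sub_le_of_discDeriv_le f.analytic hfr (u := φ 0) (v := 0) (le_max_right _ _)
      (by simp)
    have h2 : ‖f (φ 0)‖ ≤ ‖f (φ 0) - f 0‖ + ‖f 0‖ := by simpa using norm_add_le (f (φ 0) - f 0) (f 0)
    simp only [Complex.UnitDisc.coe_zero, sub_zero] at h1
    have h3 : ε / 8 * ‖(φ 0 : ℂ)‖ ≤ ε / 8 :=
      mul_le_of_le_one_right (by positivity) (φ 0).norm_lt_one.le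
    linarith
  have hw (z : 𝔻) : weight (fun z => f (φ z)) z ≤ ε / 4 := by
    rw [weight_comp f.analytic hφ]
    have h3 := weight_coe_le_one hφ z
    have h4 := weight_nonneg (fun z => (φ z : ℂ)) z
    rcases le_or_gt ‖(φ z : ℂ)‖ (max r ‖(φ 0 : ℂ)‖) with hz | hz
    · have h5 := mul_le_mul (hfr (φ z) hz) h3 h4 (by positivity)
      linarith
    · have h5 := h z ((le_max_left _ _).trans_lt hz)
      have h6 : ‖discDeriv f (φ z)‖ * weight (fun z => (φ z : ℂ)) z ≤
          ‖discDeriv f (φ z)‖ * (ε / 8 * (1 - ‖(φ z : ℂ)‖ ^ 2)) := by gcongr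
      have h7 : weight f (φ z) ≤ 2 := (f.weight_le_norm _).trans hf
      simp only [weight] at h7
      nlinarith
  have := Bloch.norm_le (f := compOp φ hφ f) h0 hw
  linarith

theorem MobiusVanishing.symm {φ ψ : 𝔻 → 𝔻} (h : MobiusVanishing 1 (-1) φ ψ)
    (hφ : IsAnalytic (fun z => (φ z : ℂ))) (hψ : IsAnalytic (fun z => (ψ z : ℂ))) :
    MobiusVanishing 1 (-1) ψ φ := by
  have hs (g : 𝔻 → ℂ) (hg : IsAnalytic g) (z : 𝔻) :
      weight (combComp 1 (-1) ψ φ g) z = weight (combComp 1 (-1) φ ψ g) z := by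
    rw [weight_combComp hφ hψ hg, weight_combComp hψ hφ hg, ← norm_neg]
    congr 1
    ring
  intro ε hε
  obtain ⟨r, hr, H⟩ := h ε hε
  refine ⟨r, hr, fun a ha z => ?_⟩
  rw [hs _ (isAnalytic_mob a), hs _ ((isAnalytic_mob a).pow 2)]
  exact H a ha z

/-- Smallness of the Möbius test functions at `φ z` controls the difference of the two compositions
at `z`, unless the Schwarz–Pick quotient of `φ` is small there. -/
theorem weight_combComp_le_or {K : ℝ} (hK : 0 < K)
    (hLip : ∀ (f : 𝔻 → ℂ) (M : ℝ), IsAnalytic f → (∀ z, weight f z ≤ M) →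
      ∀ u v : 𝔻, ‖(u : ℂ)‖ ≤ 1 / 2 → ‖(v : ℂ)‖ ≤ 1 / 2 →
        ‖discDeriv f u - discDeriv f v‖ ≤ K * M * ‖(u : ℂ) - v‖)
    {φ ψ : 𝔻 → 𝔻} (hφ : IsAnalytic (fun z => (φ z : ℂ))) (hψ : IsAnalytic (fun z => (ψ z : ℂ)))
    {z : 𝔻} {E : ℝ} (h1 : weight (combComp 1 (-1) φ ψ (fun w => (mob (φ z) w : ℂ))) z ≤ E)
    (h2 : weight (combComp 1 (-1) φ ψ (fun w => (mob (φ z) w : ℂ) ^ 2)) z ≤ E) :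
    (∀ f : 𝔻 → ℂ, IsAnalytic f → (∀ w, weight f w ≤ 2) →
      weight (combComp 1 (-1) φ ψ f) z ≤ (2 + K) * E) ∨
      weight (fun z => (φ z : ℂ)) z ≤ 2 * E * (1 - ‖(φ z : ℂ)‖ ^ 2) := by
  set a := φ z with ha
  have hm := isAnalytic_mob a
  rw [weight_combComp hφ hψ hm, ← ha] at h1
  rw [weight_combComp hφ hψ (hm.pow 2), discDeriv_pow hm, discDeriv_pow hm, ← ha, mob_self] at h2
  set P := ((1 - ‖(z : ℂ)‖ ^ 2 : ℝ) : ℂ) * discDeriv (fun z => (φ z : ℂ)) z with hP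
  set Q := ((1 - ‖(z : ℂ)‖ ^ 2 : ℝ) : ℂ) * discDeriv (fun z => (ψ z : ℂ)) z
  set S := discDeriv (fun w => (mob a w : ℂ))
  set ζ := mob a (ψ z) with hζ
  -- Since `mob a` vanishes at `φ z`, the squared test function sees only the `ψ` term.
  have h2' : 2 * (‖(ζ : ℂ)‖ * ‖S (ψ z) * Q‖) ≤ E := by
    refine le_trans (le_of_eq ?_) h2
    rw [← norm_mul, ← norm_neg, ← Complex.norm_ofNat 2, ← norm_mul]
    congr 1
    simp
    ring
  rcases le_or_gt ‖(ζ : ℂ)‖ (1 / 2) with hz | hz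
  · left
    intro f hf hf2
    have hτ := isAnalytic_mob (-a)
    have hg : IsAnalytic (fun w => f (mob (-a) w)) := hf.comp hτ
    have hg2 (w : 𝔻) : weight (fun w => f (mob (-a) w)) w ≤ 2 :=
      (weight_comp_le hf hτ w).trans (hf2 _)
    -- Writing `f = g ∘ mob a` moves `φ z` to 0 and `ψ z` to `ζ`, where `g'` is Lipschitz; the error
    -- `|g'(0) - g'(ζ)|` carries the factor `‖ζ‖` that `h2'` absorbs.
    have hfg : f = fun w => f (mob (-a) (mob a w)) := by
      funext w
      rw [mob_neg_mob]
    have hd (w : 𝔻) : discDeriv f w = discDeriv (fun w => f (mob (-a) w)) (mob a w) * S w := by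
      conv_lhs => rw [hfg]
      exact discDeriv_comp hg hm w
    rw [weight_combComp hφ hψ hf, hd, hd, ← ha, mob_self, ← hζ]
    have e1 := hLip _ 2 hg hg2 0 ζ (by simp) hz
    have e2 : ‖discDeriv (fun w => f (mob (-a) w)) 0‖ ≤ 2 := by
      have := hg2 0
      simpa [weight] using this
    set G := discDeriv (fun w => f (mob (-a) w))
    simp only [Complex.UnitDisc.coe_zero, zero_sub, norm_neg] at e1
    have e3 : 1 * (G 0 * S a * P) + -1 * (G ζ * S (ψ z) * Q) =
        G 0 * (1 * (S a * P) + -1 * (S (ψ z) * Q)) + (G 0 - G ζ) * (S (ψ z) * Q) := by ring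
    rw [e3]
    refine (norm_add_le _ _).trans ?_
    rw [norm_mul, norm_mul (G 0 - G ζ)]
    have e4 := mul_le_mul e2 h1 (norm_nonneg _) (by norm_num)
    have e5 := mul_le_mul_of_nonneg_right e1 (norm_nonneg (S (ψ z) * Q))
    have e6 := mul_le_mul_of_nonneg_left h2' hK.le
    linarith
  · right
    have e1 : ‖S (ψ z) * Q‖ ≤ E := by nlinarith [norm_nonneg (S (ψ z) * Q)]
    have e2 : ‖S a * P‖ ≤ 2 * E := by
      have e3 : S a * P = (1 * (S a * P) + -1 * (S (ψ z) * Q)) + S (ψ z) * Q := by ring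
      rw [e3]
      exact (norm_add_le _ _).trans (by linarith)
    have ha0 := one_sub_sq_pos a
    have e4 : S a = ((1 - ‖(a : ℂ)‖ ^ 2 : ℝ) : ℂ)⁻¹ := by
      have h0 : ((1 - ‖(a : ℂ)‖ ^ 2 : ℝ) : ℂ) ≠ 0 := by exact_mod_cast ha0.ne'
      have h5 := discDeriv_mob a a
      rw [star_mul_self_eq, ← Complex.ofReal_one, ← Complex.ofReal_sub] at h5
      rw [show S a = _ from h5]
      field_simp
    rw [e4, norm_mul, norm_inv, Complex.norm_real, Real.norm_eq_abs, abs_of_pos ha0,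
      inv_mul_le_iff₀ ha0, hP, ← weight_eq_norm] at e2
    linarith

theorem MobiusVanishing.isCompactOperator_sub {φ ψ : 𝔻 → 𝔻} (h : MobiusVanishing 1 (-1) φ ψ)
    (hφ : IsAnalytic (fun z => (φ z : ℂ))) (hψ : IsAnalytic (fun z => (ψ z : ℂ))) :
    IsCompactOperator (compOp φ hφ - compOp ψ hψ) := by
  refine isCompactOperator_of_small fun ε hε => ?_
  obtain ⟨K, hK, hLip⟩ := exists_lipschitz_discDeriv (r := 1 / 2) (by norm_num) (by norm_num)
  -- `2η` pays for the value at the origin and `(8 + K)η` for the seminorm.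
  obtain ⟨η, hη, hηε⟩ : ∃ η > 0, (10 + K) * η ≤ ε :=
    ⟨ε / (10 + K), by positivity, (mul_div_cancel₀ _ (by positivity)).le⟩
  obtain ⟨r₁, hr₁, H₁⟩ := h η hη
  obtain ⟨r₂, hr₂, H₂⟩ := h.symm hφ hψ η hη
  set r := max (max r₁ r₂) (max ‖(φ 0 : ℂ)‖ ‖(ψ 0 : ℂ)‖) with hr
  refine ⟨r, max_lt (max_lt hr₁ hr₂) (max_lt (φ 0).norm_lt_one (ψ 0).norm_lt_one), η, hη,
    fun f hf _ hfr => ?_⟩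
  have hf2 (w : 𝔻) : weight f w ≤ 2 := (f.weight_le_norm w).trans hf
  have h0 : ‖f (φ 0) - f (ψ 0)‖ ≤ 2 * η := by
    refine (norm_sub_le_of_discDeriv_le f.analytic hfr
      ((le_max_left _ _).trans (le_max_right _ _))
      ((le_max_right _ _).trans (le_max_right _ _))).trans ?_
    have := norm_sub_le (φ 0 : ℂ) (ψ 0)
    nlinarith [(φ 0).norm_lt_one, (ψ 0).norm_lt_one]
  have hcomb : combComp 1 (-1) φ ψ f = (compOp φ hφ - compOp ψ hψ) f := by
    funext z
    change 1 * f (φ z) + -1 * f (ψ z) = f (φ z) - f (ψ z)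
    ring
  have hcomm (z : 𝔻) : weight (combComp 1 (-1) ψ φ f) z = weight (combComp 1 (-1) φ ψ f) z := by
    rw [weight_combComp hφ hψ f.analytic, weight_combComp hψ hφ f.analytic, ← norm_neg]
    congr 1
    ring
  have hsmall {θ : 𝔻 → 𝔻} (hθ : IsAnalytic (fun z => (θ z : ℂ))) {z : 𝔻}
      (hz : ‖(θ z : ℂ)‖ ≤ r ∨
        weight (fun z => (θ z : ℂ)) z ≤ 2 * η * (1 - ‖(θ z : ℂ)‖ ^ 2)) :
      weight (fun z => f (θ z)) z ≤ 4 * η := by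
    rw [weight_comp f.analytic hθ]
    rcases hz with hz | hz
    · have := mul_le_mul (hfr _ hz) (weight_coe_le_one hθ z) (weight_nonneg _ _) hη.le
      linarith
    · have h5 := mul_le_mul_of_nonneg_left hz (norm_nonneg (discDeriv f (θ z)))
      have h6 := hf2 (θ z)
      simp only [weight] at h6
      nlinarith
  have hw (z : 𝔻) : weight (combComp 1 (-1) φ ψ f) z ≤ (8 + K) * η := by
    have hKη : 0 < K * η := by positivity
    have d₁ : weight (combComp 1 (-1) φ ψ f) z ≤ (2 + K) * η ∨ ‖(φ z : ℂ)‖ ≤ r ∨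
        weight (fun z => (φ z : ℂ)) z ≤ 2 * η * (1 - ‖(φ z : ℂ)‖ ^ 2) := by
      rcases le_or_gt ‖(φ z : ℂ)‖ r with hz | hz
      · exact Or.inr (Or.inl hz)
      · have h3 := H₁ _ (((le_max_left _ _).trans (le_max_left _ _)).trans_lt hz) z
        exact (weight_combComp_le_or hK hLip hφ hψ h3.1 h3.2).imp
          (fun h => h f f.analytic hf2) Or.inr
    have d₂ : weight (combComp 1 (-1) φ ψ f) z ≤ (2 + K) * η ∨ ‖(ψ z : ℂ)‖ ≤ r ∨
        weight (fun z => (ψ z : ℂ)) z ≤ 2 * η * (1 - ‖(ψ z : ℂ)‖ ^ 2) := by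
      rcases le_or_gt ‖(ψ z : ℂ)‖ r with hz | hz
      · exact Or.inr (Or.inl hz)
      · have h3 := H₂ _ (((le_max_right _ _).trans (le_max_left _ _)).trans_lt hz) z
        rw [← hcomm]
        exact (weight_combComp_le_or hK hLip hψ hφ h3.1 h3.2).imp
          (fun h => h f f.analytic hf2) Or.inr
    -- If neither alternative bounds the difference directly, both compositions are small
    -- separately, by `4η` each.
    rcases d₁ with d₁ | d₁
    · linarith
    rcases d₂ with d₂ | d₂
    · linarith
    have e₁ := hsmall hφ d₁
    have e₂ := hsmall hψ d₂
    have e₃ := weight_add_le ((f.analytic.comp hφ).smul 1) ((f.analytic.comp hψ).smul (-1)) z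
    rw [weight_smul _ (f.analytic.comp hφ), weight_smul _ (f.analytic.comp hψ), norm_neg, norm_one,
      one_mul, one_mul] at e₃
    have e₄ : weight (combComp 1 (-1) φ ψ f) z ≤ _ := e₃
    linarith
  rw [hcomb] at hw
  have := Bloch.norm_le (f := (compOp φ hφ - compOp ψ hψ) f) h0 hw
  linarith

/-! ### Monomials and the equivalence. -/

theorem norm_powBloch_id_le (n : ℕ) : ‖powBloch (fun z => z) isAnalytic_coe n‖ ≤ 1 + 2 := by
  refine Bloch.norm_le ?_ fun z => ?_
  · change ‖((0 : 𝔻) : ℂ) ^ n‖ ≤ 1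
    rw [norm_pow]
    exact pow_le_one₀ (norm_nonneg _) (by simp)
  · change weight (fun z : 𝔻 => (z : ℂ) ^ n) z ≤ 2
    rw [weight, discDeriv_pow isAnalytic_coe, discDeriv_coe, mul_one, norm_mul, norm_pow,
      Complex.norm_natCast]
    set x := ‖(z : ℂ)‖
    have hx0 : 0 ≤ x := norm_nonneg _
    have hx1 : x < 1 := z.norm_lt_one
    -- Multiplying by `1 - x` gives `(1 - x) n xⁿ⁻¹ ≤ 1 - xⁿ ≤ 1`; the remaining factor `1 + x` is
    -- at most 2.
    have h1 : n * x ^ (n - 1) ≤ ∑ i ∈ Finset.range n, x ^ i := by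
      rw [← nsmul_eq_mul, ← Finset.card_range n, ← Finset.sum_const, Finset.card_range]
      refine Finset.sum_le_sum fun i hi => pow_le_pow_of_le_one hx0 hx1.le ?_
      have := Finset.mem_range.1 hi
      omega
    have h2 := mul_neg_geom_sum x n
    have h3 : 0 ≤ x ^ n := pow_nonneg hx0 n
    have h4 : 0 ≤ (n : ℝ) * x ^ (n - 1) := by positivity
    have h5 := mul_le_mul_of_nonneg_left h1 (sub_nonneg.2 hx1.le)
    have h6 : 0 ≤ (1 - x) * (n * x ^ (n - 1)) := mul_nonneg (sub_nonneg.2 hx1.le) h4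
    nlinarith

end BlochSpace

theorem corollary1 (c₁ c₂ : ℂ) (hc₁ : c₁ ≠ 0) (hc₂ : c₂ ≠ 0)
    (φ ψ : 𝔻 → 𝔻)
    (hφ : BlochSpace.IsAnalytic (fun z => (φ z : ℂ)))
    (hψ : BlochSpace.IsAnalytic (fun z => (ψ z : ℂ)))
    (hCφ : ¬ IsCompactOperator (BlochSpace.compOp φ hφ))
    (hCψ : ¬ IsCompactOperator (BlochSpace.compOp ψ hψ)) :
    IsCompactOperator (c₁ • BlochSpace.compOp φ hφ + c₂ • BlochSpace.compOp ψ hψ) ↔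
      c₁ + c₂ = 0 ∧
        Tendsto (fun n : ℕ => ‖BlochSpace.powBloch φ hφ n - BlochSpace.powBloch ψ hψ n‖)
          atTop (𝓝 0) := by
  constructor
  · intro hT
    have hlim : Tendsto (fun n => c₁ • BlochSpace.powBloch φ hφ n +
        c₂ • BlochSpace.powBloch ψ hψ n) atTop (𝓝 0) := by
      refine BlochSpace.tendsto_zero_of_isCompactOperator (M := 1 + 2) hT
        (f := BlochSpace.powBloch (fun z => z) BlochSpace.isAnalytic_coe)
        BlochSpace.norm_powBloch_id_le fun z => ?_
      have h1 (w : 𝔻) := tendsto_pow_atTop_nhds_zero_of_norm_lt_one w.norm_lt_one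
      have h2 := ((h1 (φ z)).const_mul c₁).add ((h1 (ψ z)).const_mul c₂)
      rw [mul_zero, mul_zero, add_zero] at h2
      exact h2
    have hsum : c₁ + c₂ = 0 := by
      by_contra hne
      refine hCφ (BlochSpace.isCompactOperator_compOp hφ fun δ hδ => ?_)
      by_contra! hcon
      exact hne ((BlochSpace.mobiusVanishing_of_tendsto_pow hφ hψ
        (by simpa using hlim.norm)).add_eq_zero hφ hψ hc₁ hδ hcon)
    refine ⟨hsum, ?_⟩
    have h2 := (hlim.const_smul c₁⁻¹).norm
    rw [eq_neg_of_add_eq_zero_right hsum, smul_zero, norm_zero] at h2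
    refine h2.congr fun n => ?_
    rw [smul_add, smul_smul, smul_smul, mul_neg, inv_mul_cancel₀ hc₁, one_smul, neg_one_smul,
      sub_eq_add_neg]
  · rintro ⟨hsum, hlim⟩
    have hv : BlochSpace.MobiusVanishing 1 (-1) φ ψ := by
      refine BlochSpace.mobiusVanishing_of_tendsto_pow hφ hψ (hlim.congr fun n => ?_)
      rw [one_smul, neg_one_smul, sub_eq_add_neg]
    -- With `c₂ = -c₁` the operator is `c₁` times the difference.
    have hc := (hv.isCompactOperator_sub hφ hψ).smul c₁
    rw [eq_neg_of_add_eq_zero_right hsum, neg_smul, ← sub_eq_add_neg, ← smul_sub]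
    exact hc
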